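/- **Setting.** Let $\mathbb O$ be the real algebra of octonions with basis $e_0=1,e_1,\dots,e_7$ and product $e_ie_j=\epsilon_{ijk}e_k-\delta_{ij}$ ($i,j\ge 1$), where $\epsilon$ is the totally skew-symmetric symbol of the 3-form $e^{123}+e^{145}+e^{167}+e^{246}-e^{257}-e^{347}-e^{356}$. An *$\mathbb O$-bimodule* is a real vector space $M$ with unital real-bilinear multiplications $\mathbb O\times M\to M$ and $M\times\mathbb O\to M$ such that, for all $p,q\in\mathbb O$ and $m\in M$, $$[p,q,m]=-[q,p,m],\qquad [p,q,m]=[m,p,q]=[q,m,p],$$ where $[p,q,m]=(pq)m-p(qm)$, $[m,p,q]=(mp)q-m(pq)$, $[q,m,p]=(qm)p-q(mp)$. Put $\operatorname{Re}M=\{m\in M: [p,q,m]=0 \text{ for all } p,q\}$. One has $M=\bigoplus_{i=0}^7 e_i\operatorname{Re}M$, and the projection onto the component $i=0$ is $\operatorname{Re}x=\tfrac5{12}x-\tfrac1{12}\sum_{i=1}^7e_ixe_i\in\operatorname{Re}M$. Write $m=\sum_{i=0}^7 e_im_i$ with $m_i\in\operatorname{Re}M$. For a real-linear map $f:M\to M'$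 of $\mathbb O$-bimodules put $A_p(x,f)=f(px)-pf(x)$ and $B_p(f,x)=f(x)p-f(xp)$. The map $f$ is *left* (resp. *right*) *para-linear* if $\operatorname{Re}A_p(x,f)=0$ (resp. $\operatorname{Re}B_p(f,x)=0$) for all $p\in\mathbb O$, $x\in M$. The non-associative category $\mathcal{LO}$ (resp. $\mathcal{RO}$) has the $\mathbb O$-bimodules as objects, the left (resp. right) para-linear maps as morphisms, and as composition the left (resp. right) regular composition $$(f\circledcirc g)(x)=f(g(x))-\sum_{j=1}^7e_j\operatorname{Re}f(A_{e_j}(x,g)),\qquad\text{resp.}\qquad (f\circledcirc_r g)(x)=f(g(x))+\sum_{j=1}^7\bigl(\operatorname{Re}f(B_{e_j}(g,x))\bigr)e_j .$$ A functor between non-associative categories preserves identities and all compositions (reversing them if it is contravariant). The set $\operatorname{Hom}_{\mathcal{LO}}(M,X)$ is an $\mathbb O$-bimodule under $(r\odot f)(x)=f(xr)+A_r(x,f)$ and $(f\odot r)(x)=f(x)r-A_r(x,f)$. Let $\mathbb O\text{-}\mathbf{Mod}_{\mathbb R}$ be the category of $\mathbb O$-bimodules with all real-linear maps and the usual composition,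 and let $\iota$ send an object or morphism of $\mathcal{LO}$ or $\mathcal{RO}$ to itself. A sequence in $\mathcal{LO}$ or $\mathcal{RO}$ is *exact* if its image under $\iota$ is exact, that is, if the image of each map is the kernel of the next one. **Theorem.** Let $M$ be an $\mathbb O$-bimodule. 1. The functor $\operatorname{Hom}_{\mathcal{LO}}(M,-):\mathcal{LO}\to\mathcal{LO}$, $f\mapsto(g\mapsto f\circledcirc g)$, is left exact: if $0\to X\xrightarrow{f}X'\xrightarrow{g}X''$ is exact in $\mathcal{LO}$, then $$0\to\operatorname{Hom}_{\mathcal{LO}}(M,X)\to\operatorname{Hom}_{\mathcal{LO}}(M,X')\to\operatorname{Hom}_{\mathcal{LO}}(M,X'')$$ is exact in $\mathcal{LO}$. 2. The contravariant functor $\operatorname{Hom}_{\mathcal{LO}}(-,M):\mathcal{LO}\to\mathcal{RO}$, $f\mapsto(g\mapsto g\circledcirc f)$, is left exact: if $X\xrightarrow{f}X'\xrightarrow{g}X''\to0$ is exact in $\mathcal{LO}$, then $$0\to\operatorname{Hom}_{\mathcal{LO}}(X'',M)\to\operatorname{Hom}_{\mathcal{LO}}(X',M)\to\operatorname{Hom}_{\mathcal{LO}}(X,M)$$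 is exact in $\mathcal{RO}$. 3. Let $M\otimes_{\mathbb O}X=(\operatorname{Re}M\otimes_{\mathbb R}\operatorname{Re}X)\otimes_{\mathbb R}\mathbb O$, where $\mathbb O$ acts on the last factor, and let $m\otimes_{\mathbb O}x=\sum_{i,j=0}^7(m_i\otimes x_j)\otimes e_ie_j$. The functor $M\otimes^{ll}_{\mathbb O}-:\mathcal{LO}\to\mathcal{LO}$, which sends $X$ to $M\otimes_{\mathbb O}X$ and $f:X\to X'$ to the left para-linear map $$(m\otimes x)\otimes p\longmapsto p\,\bigl(m\otimes_{\mathbb O}f(x)\bigr)\qquad(m\in\operatorname{Re}M,\ x\in\operatorname{Re}X,\ p\in\mathbb O),$$ is right exact: if $X\xrightarrow{f}X'\xrightarrow{g}X''\to0$ is exact in $\mathcal{LO}$, then $$M\otimes_{\mathbb O}X\to M\otimes_{\mathbb O}X'\to M\otimes_{\mathbb O}X''\to0$$ is exact in $\mathcal{LO}$. -/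

import Mathlib

open scoped TensorProduct

universe u v w u₁ v₁ u₂ v₂

/-- The octonions: real 8-vectors, with coordinates with respect to `1, e₁, …, e₇`. -/
def Octonion : Type := Fin 8 → ℝ

namespace Octonion

noncomputable instance : AddCommGroup Octonion := inferInstanceAs (AddCommGroup (Fin 8 → ℝ))
noncomputable instance : Module ℝ Octonion := inferInstanceAs (Module ℝ (Fin 8 → ℝ))

/-- The basis `e₀ = 1, e₁, …, e₇`. -/
noncomputable def e (i : Fin 8) : Octonion := (Pi.single i 1 : Fin 8 → ℝ)

/-- `eᵢ eⱼ = εᵢⱼₖ eₖ - δᵢⱼ`, where `ε` is given by the `3`-form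
`e¹²³ + e¹⁴⁵ + e¹⁶⁷ + e²⁴⁶ - e²⁵⁷ - e³⁴⁷ - e³⁵⁶`. -/
noncomputable instance : Mul Octonion := ⟨fun x y => (![
  x 0 * y 0 - x 1 * y 1 - x 2 * y 2 - x 3 * y 3 - x 4 * y 4 - x 5 * y 5 - x 6 * y 6 - x 7 * y 7,
  x 0 * y 1 + x 1 * y 0 + (x 2 * y 3 - x 3 * y 2) + (x 4 * y 5 - x 5 * y 4)
    + (x 6 * y 7 - x 7 * y 6),
  x 0 * y 2 + x 2 * y 0 + (x 3 * y 1 - x 1 * y 3) + (x 4 * y 6 - x 6 * y 4)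
    - (x 5 * y 7 - x 7 * y 5),
  x 0 * y 3 + x 3 * y 0 + (x 1 * y 2 - x 2 * y 1) - (x 4 * y 7 - x 7 * y 4)
    - (x 5 * y 6 - x 6 * y 5),
  x 0 * y 4 + x 4 * y 0 + (x 5 * y 1 - x 1 * y 5) + (x 6 * y 2 - x 2 * y 6)
    - (x 7 * y 3 - x 3 * y 7),
  x 0 * y 5 + x 5 * y 0 + (x 1 * y 4 - x 4 * y 1) - (x 7 * y 2 - x 2 * y 7)
    - (x 6 * y 3 - x 3 * y 6),
  x 0 * y 6 + x 6 * y 0 + (x 7 * y 1 - x 1 * y 7) + (x 2 * y 4 - x 4 * y 2)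
    - (x 3 * y 5 - x 5 * y 3),
  x 0 * y 7 + x 7 * y 0 + (x 1 * y 6 - x 6 * y 1) - (x 2 * y 5 - x 5 * y 2)
    - (x 3 * y 4 - x 4 * y 3)] : Fin 8 → ℝ)⟩

noncomputable instance : One Octonion := ⟨e 0⟩

@[ext] theorem ext {x y : Octonion} (h : ∀ i, x i = y i) : x = y := funext h

@[simp] theorem add_apply (x y : Octonion) (i : Fin 8) : (x + y) i = x i + y i := rfl
@[simp] theorem sub_apply (x y : Octonion) (i : Fin 8) : (x - y) i = x i - y i := rfl
@[simp] theorem neg_apply (x : Octonion) (i : Fin 8) : (-x) i = -x i := rfl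
@[simp] theorem zero_apply (i : Fin 8) : (0 : Octonion) i = 0 := rfl
@[simp] theorem smul_apply (r : ℝ) (x : Octonion) (i : Fin 8) : (r • x) i = r * x i := rfl
theorem one_def : (1 : Octonion) = e 0 := rfl
theorem e_apply (i j : Fin 8) : e i j = if j = i then 1 else 0 := by
  simp [e, Pi.single_apply]

@[simp] theorem mul_c0 (x y : Octonion) : (x * y) 0 =
    x 0 * y 0 - x 1 * y 1 - x 2 * y 2 - x 3 * y 3 - x 4 * y 4 - x 5 * y 5
      - x 6 * y 6 - x 7 * y 7 := rfl
@[simp] theorem mul_c1 (x y : Octonion) : (x * y) 1 =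
    x 0 * y 1 + x 1 * y 0 + (x 2 * y 3 - x 3 * y 2) + (x 4 * y 5 - x 5 * y 4)
      + (x 6 * y 7 - x 7 * y 6) := rfl
@[simp] theorem mul_c2 (x y : Octonion) : (x * y) 2 =
    x 0 * y 2 + x 2 * y 0 + (x 3 * y 1 - x 1 * y 3) + (x 4 * y 6 - x 6 * y 4)
      - (x 5 * y 7 - x 7 * y 5) := rfl
@[simp] theorem mul_c3 (x y : Octonion) : (x * y) 3 =
    x 0 * y 3 + x 3 * y 0 + (x 1 * y 2 - x 2 * y 1) - (x 4 * y 7 - x 7 * y 4)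
      - (x 5 * y 6 - x 6 * y 5) := rfl
@[simp] theorem mul_c4 (x y : Octonion) : (x * y) 4 =
    x 0 * y 4 + x 4 * y 0 + (x 5 * y 1 - x 1 * y 5) + (x 6 * y 2 - x 2 * y 6)
      - (x 7 * y 3 - x 3 * y 7) := rfl
@[simp] theorem mul_c5 (x y : Octonion) : (x * y) 5 =
    x 0 * y 5 + x 5 * y 0 + (x 1 * y 4 - x 4 * y 1) - (x 7 * y 2 - x 2 * y 7)
      - (x 6 * y 3 - x 3 * y 6) := rfl
@[simp] theorem mul_c6 (x y : Octonion) : (x * y) 6 =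
    x 0 * y 6 + x 6 * y 0 + (x 7 * y 1 - x 1 * y 7) + (x 2 * y 4 - x 4 * y 2)
      - (x 3 * y 5 - x 5 * y 3) := rfl
@[simp] theorem mul_c7 (x y : Octonion) : (x * y) 7 =
    x 0 * y 7 + x 7 * y 0 + (x 1 * y 6 - x 6 * y 1) - (x 2 * y 5 - x 5 * y 2)
      - (x 3 * y 4 - x 4 * y 3) := rfl

theorem ext8 {x y : Octonion} (h0 : x 0 = y 0) (h1 : x 1 = y 1) (h2 : x 2 = y 2)
    (h3 : x 3 = y 3) (h4 : x 4 = y 4) (h5 : x 5 = y 5) (h6 : x 6 = y 6) (h7 : x 7 = y 7) :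
    x = y := by
  funext i; fin_cases i <;> assumption

noncomputable instance : NonAssocRing Octonion where
  left_distrib x y z := by
    apply ext8 <;> simp <;> ring
  right_distrib x y z := by
    apply ext8 <;> simp <;> ring
  zero_mul x := by apply ext8 <;> simp
  mul_zero x := by apply ext8 <;> simp
  one_mul x := by apply ext8 <;> simp [one_def, e_apply]
  mul_one x := by apply ext8 <;> simp [one_def, e_apply]

instance : IsScalarTower ℝ Octonion Octonion := ⟨fun r x y => by
  show (r • x) * y = r • (x * y)
  apply ext8 <;> simp <;> ring⟩

instance : SMulCommClass ℝ Octonion Octonion := ⟨fun r x y => by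
  show r • (x * y) = x * (r • y)
  apply ext8 <;> simp <;> ring⟩

theorem mul_self_mul (x y : Octonion) : x * (x * y) = (x * x) * y := by
  apply ext8 <;> simp <;> ring

theorem mul_mul_self (x y : Octonion) : (y * x) * x = y * (x * x) := by
  apply ext8 <;> simp <;> ring

theorem left_alt_aux {S : Type*} [NonAssocRing S] (H : ∀ x y : S, x * (x * y) = (x * x) * y)
    (p q r : S) : p * q * r - p * (q * r) = -(q * p * r - q * (p * r)) := by
  have h := H (p + q) r
  have h1 := H p r
  have h2 := H q r
  simp only [add_mul, mul_add] at h
  rw [h1, h2] at h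
  linear_combination (norm := abel) -h
theorem right_alt_aux {S : Type*} [NonAssocRing S] (H : ∀ x y : S, (y * x) * x = y * (x * x))
    (p q r : S) : p * q * r - p * (q * r) = -(p * r * q - p * (r * q)) := by
  have h := H (q + r) p
  have h1 := H q p
  have h2 := H r p
  simp only [add_mul, mul_add] at h
  rw [h1, h2] at h
  linear_combination (norm := abel) h
theorem left_alt (p q r : Octonion) :
    p * q * r - p * (q * r) = -(q * p * r - q * (p * r)) := left_alt_aux mul_self_mul p q r
theorem right_alt (p q r : Octonion) :
    p * q * r - p * (q * r) = -(p * r * q - p * (r * q)) := right_alt_aux mul_mul_self p q r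
theorem assoc_left (p q r : Octonion) :
    p * q * r - p * (q * r) = r * p * q - r * (p * q) := by
  rw [right_alt p q r, left_alt p r q, neg_neg]
theorem assoc_mid (p q r : Octonion) :
    r * p * q - r * (p * q) = q * r * p - q * (r * p) := assoc_left r p q

theorem eq_sum (p : Octonion) : p = p 0 • 1 + ∑ i : Fin 7, p i.succ • e i.succ := by
  apply ext8 <;> simp [Fin.sum_univ_seven, one_def, e_apply]

end Octonion

/-- An `𝕆`-bimodule: `L p m` is `p m`, `R p m` is `m p`. The axioms are unitality and
`[p,q,m] = -[q,p,m]`, `[p,q,m] = [m,p,q] = [q,m,p]`. -/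
class OctBimodule (M : Type u) [AddCommGroup M] [Module ℝ M] where
  L : Octonion →ₗ[ℝ] M →ₗ[ℝ] M
  R : Octonion →ₗ[ℝ] M →ₗ[ℝ] M
  one_L : ∀ m, L 1 m = m
  R_one : ∀ m, R 1 m = m
  left_alt : ∀ p q m, L (p * q) m - L p (L q m) = -(L (q * p) m - L q (L p m))
  assoc_left : ∀ p q m, L (p * q) m - L p (L q m) = R q (R p m) - R (p * q) m
  assoc_mid : ∀ p q m, R q (R p m) - R (p * q) m = R p (L q m) - L q (R p m)

namespace OctBimodule
open Octonion
theorem A_cyc_aux {M : Type u} [AddCommGroup M] {a1 a2 a3 a4 a5 a6 a7 a8 a9 a10 a11 a12 a13 a14 a15 a16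
    b1 b2 b3 b4 u1 u2 u3 u4 : M}
    (h1 : a1 - a2 + a3 = b1 + b2) (h2 : a4 - a1 + a2 = b3 + u1) (h3 : a5 - a6 + a7 = u3 + b4)
    (h4 : a8 - a9 + a10 = b1 + u2) (h5 : a11 - a12 + a13 = u4 + b2)
    (h6 : a9 - a10 + a14 = b3 + b4) (h7 : a3 = -a5) (h8 : a11 = -a14) (h9 : a15 = -a8)
    (h10 : a16 = -a4) (h11 : a1 = -a12) (h12 : a9 = -a6) :
    a15 - a16 + (a9 - a13) + (a7 - a1) = u1 - u2 + u3 - u4 := by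
  linear_combination (norm := module) h1 + h2 + h3 - h4 - h5 - h6 - h7 + h8 + h9 - h10 - h11 + h12

variable {M : Type u} [AddCommGroup M] [Module ℝ M] [OctBimodule M]

/-- `[p,q,m]` -/
noncomputable def A (p q : Octonion) (m : M) : M := L (p * q) m - L p (L q m)

theorem A_skew (p q : Octonion) (m : M) : A p q m = - A q p m := left_alt p q m
theorem L_L (p q : Octonion) (m : M) : L p (L q m) = L (p * q) m - A p q m := by simp [A]
theorem R_R (p q : Octonion) (m : M) : R q (R p m) = R (p * q) m + A p q m := by
  have := assoc_left p q m; rw [A, this]; abel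
theorem R_L (p q : Octonion) (m : M) : R p (L q m) = L q (R p m) + A p q m := by
  rw [A, assoc_left, assoc_mid]; abel
@[simp] theorem A_add (p q : Octonion) (m n : M) : A p q (m + n) = A p q m + A p q n := by
  simp [A]; abel
@[simp] theorem A_sub (p q : Octonion) (m n : M) : A p q (m - n) = A p q m - A p q n := by
  simp [A]; abel

@[simp] theorem A_neg (p q : Octonion) (m : M) : A p q (-m) = - A p q m := by
  simp [A]; abel
@[simp] theorem A_smul (p q : Octonion) (r : ℝ) (m : M) : A p q (r • m) = r • A p q m := by
  simp [A, smul_sub]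
theorem A_sub_right (p q r : Octonion) (m : M) : A p (q - r) m = A p q m - A p r m := by
  simp [A, mul_sub]; abel
theorem A_neg_right (p q : Octonion) (m : M) : A p (-q) m = - A p q m := by
  simp [A]; abel

theorem teich4 (p q r : Octonion) (m : M) :
    A (p * q) r m - A p (q * r) m + A p q (L r m)
      = L p (A q r m) + L ((p * q) * r - p * (q * r)) m := by
  simp only [A, map_sub, LinearMap.sub_apply]; abel
theorem teich3 (p q r : Octonion) (m : M) :
    A r (p * q) m - A r p (L q m) + A p q (R r m)
      = L p (A r q m) + R r (A p q m) := by
  have h1 := R_L r (p * q) m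
  have h2 := R_L r p (L q m)
  have h3 := congrArg (L p) (R_L r q m)
  simp only [A, map_sub, map_add] at *
  linear_combination (norm := module) h2 - h1 + h3
theorem teich1 (p q r : Octonion) (m : M) :
    A q r (R p m) - A (p * q) r m + A p (q * r) m
      = R ((p * q) * r - p * (q * r)) m + R r (A p q m) := by
  have h1 := R_R q r (R p m)
  have h2 := R_R (p * q) r m
  have h3 := R_R p (q * r) m
  have h4 := congrArg (R r) (R_R p q m)
  simp only [map_sub, map_add, LinearMap.sub_apply] at *
  linear_combination (norm := module) h2 - h1 - h3 + h4

theorem A_cyc (p q r : Octonion) (m : M) :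
    A p (q * r) m - A p (r * q) m + (A q (r * p) m - A q (p * r) m)
      + (A r (p * q) m - A r (q * p) m)
    = L ((r * q) * p - r * (q * p)) m - L ((q * r) * p - q * (r * p)) m
      + R ((r * p) * q - r * (p * q)) m - R ((q * p) * r - q * (p * r)) m :=
  A_cyc_aux (teich3 q p r m) (teich4 r q p m) (teich1 r p q m) (teich4 q r p m)
    (teich1 q p r m) (teich3 r p q m) (A_skew q p (R r m)) (A_skew p r (R q m))
    (A_skew p (q * r) m) (A_skew p (r * q) m) (A_skew r (q * p) m) (A_skew q (r * p) m)

/-- A quaternionic triple of imaginary units. -/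
structure Line (a b c : Octonion) : Prop where
  aa : a * a = -1
  bb : b * b = -1
  ab : a * b = c
  ba : b * a = -c
  bc : b * c = a
  cb : c * b = -a
  ca : c * a = b
  ac : a * c = -b

theorem L_sq {a : Octonion} (h : a * a = -1) (m : M) : L a (L a m) = -m := by
  have := left_alt a a m
  rw [h] at this
  simp only [map_neg, LinearMap.neg_apply, one_L] at this
  have h2 : (2 : ℝ) • (L a (L a m) + m) = 0 := by linear_combination (norm := module) -this
  have := (smul_eq_zero.mp h2).resolve_left two_ne_zero
  linear_combination (norm := module) this

theorem A_self (a : Octonion) (m : M) : A a a m = 0 := by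
  have := A_skew a a m
  have h2 : (2 : ℝ) • A a a m = 0 := by linear_combination (norm := module) this
  exact (smul_eq_zero.mp h2).resolve_left two_ne_zero

theorem R_sq {a : Octonion} (h : a * a = -1) (m : M) : R a (R a m) = -m := by
  rw [R_R, A_self, h]; simp [R_one]

theorem R_L_self (a : Octonion) (m : M) : R a (L a m) = L a (R a m) := by
  rw [R_L, A_self, add_zero]

/-- Left minus right multiplication. -/
noncomputable def D (a : Octonion) (m : M) : M := L a m - R a m

theorem U_D_self {c : Octonion} (h : c * c = -1) (m : M) : L c (R c (D c m)) = D c m := by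
  simp only [D, map_sub, R_L_self, L_sq h, R_sq h, map_neg]; module
theorem D_U_self {c : Octonion} (h : c * c = -1) (m : M) : D c (L c (R c m)) = D c m := by
  simp only [D, R_L_self, L_sq h, R_sq h, map_neg]; module
theorem L_U_self {c : Octonion} (h : c * c = -1) (m : M) :
    L c (L c (R c m)) + L c (R c (L c m)) = -(2 : ℝ) • R c m := by
  rw [R_L_self, L_sq h]; module

namespace Line
variable {a b c : Octonion}

theorem swap (h : Line a b c) : Line b (-a) c := by
  constructor <;> simp [h.aa, h.bb, h.ab, h.ba, h.bc, h.cb, h.ca, h.ac]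

theorem L_A (h : Line a b c) (m : M) : L a (A a c m) = A a b m := by
  simp only [A, map_sub, h.ac, L_sq h.aa, h.ab, map_neg, LinearMap.neg_apply]; module
theorem A_R (h : Line a b c) (m : M) : A a c (R a m) = A a b m := by
  have h1 := R_R a c (R a m)
  have h2 := R_R a b m
  rw [R_sq h.aa, h.ac] at h1
  rw [h.ab] at h2
  simp only [map_neg, LinearMap.neg_apply] at *
  linear_combination (norm := module) h2 - h1
theorem L_c_L_a (h : Line a b c) (m : M) : L c (L a m) = - L a (L c m) := by
  have := A_skew a c m
  simp only [A, h.ac, h.ca, map_neg, LinearMap.neg_apply] at this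
  linear_combination (norm := module) -this
theorem R_c_R_a (h : Line a b c) (m : M) : R c (R a m) = - R a (R c m) := by
  have := A_skew a c m
  have h1 := R_R a c m
  have h2 := R_R c a m
  simp only [h.ac, h.ca, map_neg, LinearMap.neg_apply] at h1 h2
  linear_combination (norm := module) this + h1 + h2
theorem U_L (h : Line a b c) (m : M) : L a (R a (L c m)) = - L b (R a m) := by
  have h1 := congrArg (L a) (R_L a c m)
  have h2 := L_L a c (R a m)
  rw [h.A_R, h.ac] at h2
  rw [map_add, h.L_A] at h1
  simp only [map_neg, LinearMap.neg_apply] at *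
  linear_combination (norm := module) h1 + h2
theorem A_L (h : Line a b c) (m : M) : A a c (L a m) = - A a b m := by
  have h1 := A_skew a c (L a m)
  have h2 := A_skew a b m
  simp only [A, h.ca, h.ba, h.ac, h.ab, L_sq h.aa, map_neg, LinearMap.neg_apply] at *
  linear_combination (norm := module) h1 + h2
theorem R_A (h : Line a b c) (m : M) : R a (A a c m) = - A a b m := by
  have h1 := congrArg (R a) (R_R a c m)
  have h2 := R_R b a m
  have h3 := h.R_c_R_a (R a m)
  have h4 := A_skew a b m
  rw [R_sq h.aa] at h3
  rw [h.ba] at h2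
  simp only [h.ac, map_neg, LinearMap.neg_apply, map_add] at *
  linear_combination (norm := module) -h1 + h2 + h3 + h4
theorem U_R (h : Line a b c) (m : M) : L a (R a (R c m)) = R b (L a m) := by
  have h1 := R_R c a (L a m)
  have h2 := congrArg (R a) (R_L c a m)
  have h3 := R_L_self a (R c m)
  rw [map_add, A_skew c a m, map_neg, h.R_A, h3] at h2
  rw [A_skew c a, h.A_L, h.ca] at h1
  linear_combination (norm := module) h1 - h2
theorem A_swap (m : M) : A b (-a) m = A a b m := by
  rw [A_neg_right, A_skew]; simp

/-- `(U_a + U_b) D_c = 2 [a, b, ·]` -/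
theorem U_D (h : Line a b c) (m : M) : L a (R a (D c m)) + L b (R b (D c m)) = (2 : ℝ) • A a b m := by
  have h1 := h.U_L m
  have h2 := h.U_R m
  have h3 := h.swap.U_L m
  have h4 := h.swap.U_R m
  have h5 := R_L a b m
  have h6 := R_L b a m
  have h7 := A_skew b a m
  simp only [D, map_sub, map_neg, LinearMap.neg_apply] at *
  linear_combination (norm := module) h1 - h2 + h3 - h4 + h5 - h6 - h7
theorem L_U (h : Line a b c) (m : M) : L c (L a (R a m)) = L b (R a m) + A a b m := by
  have h1 := h.L_c_L_a (R a m)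
  have h2 := R_L a c m
  have h3 := congrArg (L a) h2
  rw [map_add, h.L_A] at h3
  have h4 := h.U_L m
  linear_combination (norm := module) h1 + h3 - h4
theorem R_U (h : Line a b c) (m : M) : R c (L a (R a m)) = - R b (L a m) - A a b m := by
  have h1 := h.R_c_R_a (L a m)
  have h2 := congrArg (R a) (R_L c a m)
  have h3 := R_L_self a m
  have h4 := h.U_R m
  have h5 := R_L_self a (R c m)
  rw [map_add, A_skew c a m, map_neg, h.R_A] at h2
  rw [h3] at h1
  linear_combination (norm := module) h1 - h2 - h4 - h5

theorem D_U (h : Line a b c) (m : M) : D c (L a (R a m)) + D c (L b (R b m)) = (2 : ℝ) • A a b m := by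
  have h1 := h.L_U m
  have h2 := h.R_U m
  have h3 := h.swap.L_U m
  have h4 := h.swap.R_U m
  have h5 := R_L a b m
  have h6 := R_L b a m
  have h7 := A_skew b a m
  have h8 := A_swap (a := a) (b := b) m
  simp only [D, map_neg, LinearMap.neg_apply] at *
  linear_combination (norm := module) h1 - h2 + h3 - h4 + 2 • h8 + h6 - h5 + h7

theorem LU_UL (h : Line a b c) (m : M) : L c (L a (R a m)) + L a (R a (L c m))
    + (L c (L b (R b m)) + L b (R b (L c m))) = (2 : ℝ) • A a b m := by
  have h1 := h.L_U m
  have h2 := h.U_L m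
  have h3 := h.swap.L_U m
  have h4 := h.swap.U_L m
  have h8 := A_swap (a := a) (b := b) m
  simp only [map_neg, LinearMap.neg_apply] at *
  linear_combination (norm := module) h1 + h2 + h3 + h4 + h8
end Line

/-- Three lines through `c`. -/
structure Frame (c p x q y r z : Octonion) : Prop where
  cc : c * c = -1
  l1 : Line p x c
  l2 : Line q y c
  l3 : Line r z c
  qr : q * r = x
  rq : r * q = -x
  rp : r * p = y
  pr : p * r = -y
  pq : p * q = z
  qp : q * p = -z

namespace Frame
variable {c p x q y r z : Octonion}

theorem A_sum (h : Frame c p x q y r z) (m : M) : A p x m + A q y m + A r z m = (2 : ℝ) • D c m := by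
  have := A_cyc p q r m
  rw [h.qr, h.rq, h.rp, h.pr, h.pq, h.qp] at this
  simp only [A_neg_right, neg_mul, mul_neg, h.l1.ba, h.l2.ba, h.l2.ab, h.l3.ba, h.l3.ab,
    map_neg, map_sub, LinearMap.neg_apply, LinearMap.sub_apply, neg_neg] at this
  have h2 : (2 : ℝ) • (A p x m + A q y m + A r z m - (2 : ℝ) • D c m) = 0 := by
    simp only [D]
    linear_combination (norm := module) this
  exact sub_eq_zero.mp ((smul_eq_zero.mp h2).resolve_left two_ne_zero)

/-- The sum of the operators `m ↦ e (m e)` over a frame. -/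
theorem U_D (h : Frame c p x q y r z) (m : M) : L c (R c (D c m)) + (L p (R p (D c m)) + L x (R x (D c m)))
    + (L q (R q (D c m)) + L y (R y (D c m))) + (L r (R r (D c m)) + L z (R z (D c m)))
    = (5 : ℝ) • D c m := by
  rw [h.l1.U_D, h.l2.U_D, h.l3.U_D, U_D_self h.cc]
  linear_combination (norm := module) (2 : ℝ) • h.A_sum m
theorem D_U (h : Frame c p x q y r z) (m : M) : D c (L c (R c m)) + (D c (L p (R p m)) + D c (L x (R x m)))
    + (D c (L q (R q m)) + D c (L y (R y m))) + (D c (L r (R r m)) + D c (L z (R z m)))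
    = (5 : ℝ) • D c m := by
  rw [h.l1.D_U, h.l2.D_U, h.l3.D_U, D_U_self h.cc]
  linear_combination (norm := module) (2 : ℝ) • h.A_sum m
theorem LU_UL (h : Frame c p x q y r z) (m : M) : L c (L c (R c m)) + L c (R c (L c m))
    + (L c (L p (R p m)) + L p (R p (L c m)) + (L c (L x (R x m)) + L x (R x (L c m))))
    + (L c (L q (R q m)) + L q (R q (L c m)) + (L c (L y (R y m)) + L y (R y (L c m))))
    + (L c (L r (R r m)) + L r (R r (L c m)) + (L c (L z (R z m)) + L z (R z (L c m))))
    = (4 : ℝ) • L c m - (6 : ℝ) • R c m := by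
  rw [h.l1.LU_UL, h.l2.LU_UL, h.l3.LU_UL, L_U_self h.cc]
  have := h.A_sum m
  simp only [D] at this
  linear_combination (norm := module) (2 : ℝ) • this
end Frame

theorem anti {a b : Octonion} (h : a 0 = 0) (k : b 0 = 0)
    (hk : a 1 * b 1 + a 2 * b 2 + a 3 * b 3 + a 4 * b 4 + a 5 * b 5 + a 6 * b 6 + a 7 * b 7 = 0) :
    b * a = -(a * b) := by
  apply ext8 <;> simp [h, k]
  · linear_combination (-2 : ℝ) * hk
  all_goals ring

theorem Line.mk' {a b c : Octonion} (aa : a * a = -1) (bb : b * b = -1) (ab : a * b = c)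
    (ba : b * a = -(a * b)) : Line a b c where
  aa := aa
  bb := bb
  ab := ab
  ba := by rw [ba, ab]
  bc := by
    have : b * (b * a) = -a := by rw [mul_self_mul, bb, neg_one_mul]
    rw [ba, ab, mul_neg] at this
    exact neg_injective this
  cb := by rw [← ab, mul_mul_self, bb, mul_neg, mul_one]
  ca := by
    have : (b * a) * a = -b := by rw [mul_mul_self, aa, mul_neg, mul_one]
    rw [ba, ab, neg_mul] at this
    exact neg_injective this
  ac := by rw [← ab, mul_self_mul, aa, neg_one_mul]

theorem e_mul_self (i : Fin 7) : e i.succ * e i.succ = -1 := by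
  fin_cases i <;> apply ext8 <;> simp [e_apply, one_def]

theorem Frame.mk' {c p x q y r z : Octonion} (cc : c * c = -1)
    (pp : p * p = -1) (xx : x * x = -1) (qq : q * q = -1) (yy : y * y = -1)
    (rr : r * r = -1) (zz : z * z = -1)
    (px : p * x = c) (qy : q * y = c) (rz : r * z = c)
    (qr : q * r = x) (rp : r * p = y) (pq : p * q = z)
    (xp : x * p = -(p * x)) (yq : y * q = -(q * y)) (zr : z * r = -(r * z))
    (rq : r * q = -(q * r)) (pr : p * r = -(r * p)) (qp : q * p = -(p * q)) :
    Frame c p x q y r z where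
  cc := cc
  l1 := Line.mk' pp xx px xp
  l2 := Line.mk' qq yy qy yq
  l3 := Line.mk' rr zz rz zr
  qr := qr
  rq := by rw [rq, qr]
  rp := rp
  pr := by rw [pr, rp]
  pq := pq
  qp := by rw [qp, pq]

theorem frame1 : Frame (e 1) (e 2) (e 3) (e 4) (e 5) (-e 7) (e 6) := by
  refine Frame.mk' (e_mul_self 0) (e_mul_self 1) (e_mul_self 2) (e_mul_self 3)
    (e_mul_self 4) (by rw [neg_mul_neg]; exact e_mul_self 6) (e_mul_self 5)
    ?_ ?_ ?_ ?_ ?_ ?_ (anti ?_ ?_ ?_) (anti ?_ ?_ ?_) (anti ?_ ?_ ?_)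
    (anti ?_ ?_ ?_) (anti ?_ ?_ ?_) (anti ?_ ?_ ?_)
  iterate 6 · apply ext8 <;> simp [e_apply]
  all_goals simp [e_apply]
theorem frame2 : Frame (e 2) (e 1) (-e 3) (e 4) (e 6) (e 7) (e 5) := by
  refine Frame.mk' (e_mul_self 1) (e_mul_self 0) (by rw [neg_mul_neg]; exact e_mul_self 2) (e_mul_self 3)
    (e_mul_self 5) (e_mul_self 6) (e_mul_self 4)
    ?_ ?_ ?_ ?_ ?_ ?_ (anti ?_ ?_ ?_) (anti ?_ ?_ ?_) (anti ?_ ?_ ?_)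
    (anti ?_ ?_ ?_) (anti ?_ ?_ ?_) (anti ?_ ?_ ?_)
  iterate 6 · apply ext8 <;> simp [e_apply]
  all_goals simp [e_apply]
theorem frame3 : Frame (e 3) (e 1) (e 2) (e 4) (-e 7) (e 6) (e 5) := by
  refine Frame.mk' (e_mul_self 2) (e_mul_self 0) (e_mul_self 1) (e_mul_self 3)
    (by rw [neg_mul_neg]; exact e_mul_self 6) (e_mul_self 5) (e_mul_self 4)
    ?_ ?_ ?_ ?_ ?_ ?_ (anti ?_ ?_ ?_) (anti ?_ ?_ ?_) (anti ?_ ?_ ?_)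
    (anti ?_ ?_ ?_) (anti ?_ ?_ ?_) (anti ?_ ?_ ?_)
  iterate 6 · apply ext8 <;> simp [e_apply]
  all_goals simp [e_apply]
theorem frame4 : Frame (e 4) (e 1) (-e 5) (e 6) (e 2) (e 3) (e 7) := by
  refine Frame.mk' (e_mul_self 3) (e_mul_self 0) (by rw [neg_mul_neg]; exact e_mul_self 4) (e_mul_self 5)
    (e_mul_self 1) (e_mul_self 2) (e_mul_self 6)
    ?_ ?_ ?_ ?_ ?_ ?_ (anti ?_ ?_ ?_) (anti ?_ ?_ ?_) (anti ?_ ?_ ?_)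
    (anti ?_ ?_ ?_) (anti ?_ ?_ ?_) (anti ?_ ?_ ?_)
  iterate 6 · apply ext8 <;> simp [e_apply]
  all_goals simp [e_apply]
theorem frame5 : Frame (e 5) (e 1) (e 4) (e 2) (e 7) (-e 6) (e 3) := by
  refine Frame.mk' (e_mul_self 4) (e_mul_self 0) (e_mul_self 3) (e_mul_self 1)
    (e_mul_self 6) (by rw [neg_mul_neg]; exact e_mul_self 5) (e_mul_self 2)
    ?_ ?_ ?_ ?_ ?_ ?_ (anti ?_ ?_ ?_) (anti ?_ ?_ ?_) (anti ?_ ?_ ?_)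
    (anti ?_ ?_ ?_) (anti ?_ ?_ ?_) (anti ?_ ?_ ?_)
  iterate 6 · apply ext8 <;> simp [e_apply]
  all_goals simp [e_apply]
theorem frame6 : Frame (e 6) (e 1) (-e 7) (e 2) (e 4) (e 5) (e 3) := by
  refine Frame.mk' (e_mul_self 5) (e_mul_self 0) (by rw [neg_mul_neg]; exact e_mul_self 6) (e_mul_self 1)
    (e_mul_self 3) (e_mul_self 4) (e_mul_self 2)
    ?_ ?_ ?_ ?_ ?_ ?_ (anti ?_ ?_ ?_) (anti ?_ ?_ ?_) (anti ?_ ?_ ?_)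
    (anti ?_ ?_ ?_) (anti ?_ ?_ ?_) (anti ?_ ?_ ?_)
  iterate 6 · apply ext8 <;> simp [e_apply]
  all_goals simp [e_apply]
theorem frame7 : Frame (e 7) (e 1) (e 6) (e 2) (-e 5) (e 4) (e 3) := by
  refine Frame.mk' (e_mul_self 6) (e_mul_self 0) (e_mul_self 5) (e_mul_self 1)
    (by rw [neg_mul_neg]; exact e_mul_self 4) (e_mul_self 3) (e_mul_self 2)
    ?_ ?_ ?_ ?_ ?_ ?_ (anti ?_ ?_ ?_) (anti ?_ ?_ ?_) (anti ?_ ?_ ?_)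
    (anti ?_ ?_ ?_) (anti ?_ ?_ ?_) (anti ?_ ?_ ?_)
  iterate 6 · apply ext8 <;> simp [e_apply]
  all_goals simp [e_apply]
end OctBimodule

namespace OctBimodule
open Octonion
variable {M : Type u} [AddCommGroup M] [Module ℝ M] [OctBimodule M]

/-- The real part `Re x = 5/12 x - 1/12 ∑ᵢ eᵢ x eᵢ`. By `re_mem`, `mem_nucleus_iff` and `decomp`
it is the projection of `M = ⊕ᵢ eᵢ (nucleus M)` onto the nucleus. -/
noncomputable def re : M →ₗ[ℝ] M :=
  (5 / 12 : ℝ) • LinearMap.id -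
    (1 / 12 : ℝ) • ∑ i : Fin 7, L (e i.succ) ∘ₗ R (e i.succ)

theorem re_apply (x : M) :
    re x = (5 / 12 : ℝ) • x - (1 / 12 : ℝ) • ∑ i : Fin 7, L (e i.succ) (R (e i.succ) x) := by
  simp [re]

/-- The set of associative elements, which is the real part `Re M` of the bimodule. -/
def nucleus (M : Type u) [AddCommGroup M] [Module ℝ M] [OctBimodule M] : Submodule ℝ M where
  carrier := {x | ∀ p q : Octonion, A p q x = 0}
  add_mem' hx hy p q := by simp [hx p q, hy p q]
  zero_mem' p q := by simp [A]
  smul_mem' r x hx p q := by simp [hx p q]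

theorem sums (i : Fin 7) (m : M) :
    (∑ j : Fin 7, L (e j.succ) (R (e j.succ) (D (e i.succ) m)) = (5 : ℝ) • D (e i.succ) m) ∧
    (∑ j : Fin 7, D (e i.succ) (L (e j.succ) (R (e j.succ) m)) = (5 : ℝ) • D (e i.succ) m) ∧
    (∑ j : Fin 7, (L (e i.succ) (L (e j.succ) (R (e j.succ) m))
      + L (e j.succ) (R (e j.succ) (L (e i.succ) m)))
      = (4 : ℝ) • L (e i.succ) m - (6 : ℝ) • R (e i.succ) m) := by
  have aux : ∀ {c p x q y r z : Octonion}, Frame c p x q y r z →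
      (∀ F : Octonion → M, (∀ a, F (-a) = F a) → ∑ j : Fin 7, F (e j.succ)
        = F c + (F p + F x) + (F q + F y) + (F r + F z)) →
      (∑ j : Fin 7, L (e j.succ) (R (e j.succ) (D c m)) = (5 : ℝ) • D c m) ∧
      (∑ j : Fin 7, D c (L (e j.succ) (R (e j.succ) m)) = (5 : ℝ) • D c m) ∧
      (∑ j : Fin 7, (L c (L (e j.succ) (R (e j.succ) m))
      + L (e j.succ) (R (e j.succ) (L c m)))
      = (4 : ℝ) • L c m - (6 : ℝ) • R c m) := by
    intro c p x q y r z h hs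
    refine ⟨?_, ?_, ?_⟩
    · rw [hs (fun a => L a (R a (D c m))) (by simp), h.U_D]
    · rw [hs (fun a => D c (L a (R a m))) (by simp), h.D_U]
    · rw [hs (fun a => L c (L a (R a m)) + L a (R a (L c m))) (by simp), h.LU_UL]
  fin_cases i
  · exact aux frame1 fun F hF => by simp [Fin.sum_univ_seven, hF]; abel
  · exact aux frame2 fun F hF => by simp [Fin.sum_univ_seven, hF]; abel
  · exact aux frame3 fun F hF => by simp [Fin.sum_univ_seven, hF]; abel
  · exact aux frame4 fun F hF => by simp [Fin.sum_univ_seven, hF]; abel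
  · exact aux frame5 fun F hF => by simp [Fin.sum_univ_seven, hF]; abel
  · exact aux frame6 fun F hF => by simp [Fin.sum_univ_seven, hF]; abel
  · exact aux frame7 fun F hF => by simp [Fin.sum_univ_seven, hF]; abel

/-- A linear identity in an octonion may be checked on `1` and the `eᵢ`. -/
theorem lin_ext {N : Type v} [AddCommGroup N] [Module ℝ N] {f g : Octonion →ₗ[ℝ] N}
    (h0 : f 1 = g 1) (h : ∀ i : Fin 7, f (e i.succ) = g (e i.succ)) (p : Octonion) :
    f p = g p := by
  rw [eq_sum p]; simp [h0, h]

theorem re_L_eq_re_R (p : Octonion) (m : M) : re (L p m) = re (R p m) := by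
  refine lin_ext (f := re ∘ₗ L.flip m) (g := re ∘ₗ R.flip m) (by simp [one_L, R_one])
    (fun i => ?_) p
  have h := (sums i m).1
  have : re (D (e i.succ) m) = 0 := by
    rw [re_apply, h]; module
  simp only [D, map_sub] at this
  simpa using sub_eq_zero.mp this

theorem L_re_eq_R_re (p : Octonion) (m : M) : L p (re m) = R p (re m) := by
  refine lin_ext (f := L.flip (re m)) (g := R.flip (re m)) (by simp [one_L, R_one])
    (fun i => ?_) p
  have h := (sums i m).2.1
  have : D (e i.succ) (re m) = 0 := by
    simp only [D, re_apply, map_sub, map_smul, map_sum, Finset.sum_sub_distrib] at h ⊢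
    linear_combination (norm := module) (-1 / 12 : ℝ) • h
  simp only [D] at this
  simpa using sub_eq_zero.mp this

theorem L_add_R (i : Fin 7) (m : M) : L (e i.succ) m + R (e i.succ) m
    = (2 : ℝ) • (L (e i.succ) (re m) + re (L (e i.succ) m)) := by
  have h := (sums i m).2.2
  simp only [re_apply, map_sub, map_smul, map_sum, Finset.sum_add_distrib] at h ⊢
  linear_combination (norm := module) (1 / 6 : ℝ) • h

theorem mem_nucleus_of_central {z : M} (h : ∀ p, L p z = R p z) : z ∈ nucleus M := by
  intro p q
  have h1 := R_R p q z
  have h2 := R_L q p z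
  have h3 := A_skew q p z
  have h4 : A p q z = L (p * q) z - L p (L q z) := rfl
  rw [h p] at h2
  rw [h q, h (p * q)] at h4
  have : (3 : ℝ) • A p q z = 0 := by
    linear_combination (norm := module) h4 + h2 - h1 + h3
  exact (smul_eq_zero.mp this).resolve_left three_ne_zero

theorem re_mem (m : M) : re m ∈ nucleus M :=
  mem_nucleus_of_central fun p => L_re_eq_R_re p m

theorem L_eq_R_of_mem {z : M} (hz : z ∈ nucleus M) (p : Octonion) : L p z = R p z := by
  have aux : ∀ {c p x q y r w : Octonion}, Frame c p x q y r w → L c z = R c z := by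
    intro c p x q y r w h
    have := h.A_sum z
    rw [hz, hz, hz] at this
    have h0 : (2 : ℝ) • D c z = 0 := by rw [← this]; simp
    have h2 : D c z = 0 := (smul_eq_zero.mp h0).resolve_left two_ne_zero
    exact sub_eq_zero.mp h2
  refine lin_ext (f := L.flip z) (g := R.flip z) (by simp [one_L, R_one]) (fun i => ?_) p
  fin_cases i
  exacts [aux frame1, aux frame2, aux frame3, aux frame4, aux frame5, aux frame6, aux frame7]

theorem e_sq (i : Fin 7) : e i.succ * e i.succ = -1 := by
  fin_cases i
  exacts [frame1.cc, frame2.cc, frame3.cc, frame4.cc, frame5.cc, frame6.cc, frame7.cc]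

theorem re_eq_self {z : M} (hz : z ∈ nucleus M) : re z = z := by
  rw [re_apply]
  simp only [← L_eq_R_of_mem hz, L_sq (e_sq _)]
  simp
  module

theorem mem_nucleus_iff {z : M} : z ∈ nucleus M ↔ re z = z :=
  ⟨re_eq_self, fun h => h ▸ re_mem z⟩

@[simp] theorem re_re (m : M) : re (re m) = re m := re_eq_self (re_mem m)

theorem re_L_e {z : M} (hz : z ∈ nucleus M) (i : Fin 7) : re (L (e i.succ) z) = 0 := by
  have h := L_add_R i z
  rw [← L_eq_R_of_mem hz, re_eq_self hz] at h
  have : (2 : ℝ) • re (L (e i.succ) z) = 0 := by linear_combination (norm := module) -h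
  exact (smul_eq_zero.mp this).resolve_left two_ne_zero

theorem re_L_of_mem {z : M} (hz : z ∈ nucleus M) (p : Octonion) : re (L p z) = p 0 • z := by
  conv_lhs => rw [eq_sum p]
  simp [re_L_e hz, one_L, re_eq_self hz]

theorem decomp (m : M) :
    m = re m - ∑ i : Fin 7, L (e i.succ) (re (L (e i.succ) m)) := by
  have h : ∀ i : Fin 7, (2 : ℝ) • L (e i.succ) (R (e i.succ) m) - (2 : ℝ) • m
      = (4 : ℝ) • L (e i.succ) (re (L (e i.succ) m)) - (4 : ℝ) • re m := by
    intro i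
    have h1 := L_add_R i (L (e i.succ) m + R (e i.succ) m)
    rw [L_add_R i m] at h1
    have h2 := L_sq (e_sq i) m
    have h3 := R_sq (e_sq i) m
    have h4 := R_L_self (e i.succ) m
    have h5 := congrArg (L (e i.succ)) (L_add_R i m)
    have h6 := congrArg (R (e i.succ)) (L_add_R i m)
    have h7 := L_sq (e_sq i) (re m)
    have h8 := L_re_eq_R_re (e i.succ) (L (e i.succ) m)
    have h9 := R_L_self (e i.succ) (re m)
    have h10 := congrArg (L (e i.succ)) (L_re_eq_R_re (e i.succ) m)
    simp only [map_add, map_smul] at h5 h6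
    linear_combination (norm := module) h5 + h6 - h2 - h3 - h4 + (2 : ℝ) • h7 + (2 : ℝ) • h9
      - (2 : ℝ) • h8 - (2 : ℝ) • h10 + (2 : ℝ) • h7
  have hs := Finset.sum_congr (rfl : (Finset.univ : Finset (Fin 7)) = Finset.univ)
    fun i _ => h i
  have hr := re_apply m
  simp only [Finset.sum_sub_distrib, ← Finset.smul_sum] at hs
  simp only [Finset.sum_const, Finset.card_univ, Fintype.card_fin] at hs
  linear_combination (norm := module) (-1 / 4 : ℝ) • hs + (6 : ℝ) • hr

theorem re_A (p q : Octonion) (m : M) : re (A p q m) = 0 := by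
  have h1 := congrArg re (R_L p q m)
  have h2 := congrArg re (L_L p q m)
  have h3 := congrArg re (R_R p q m)
  have h4 := re_L_eq_re_R p (L q m)
  have h5 := re_L_eq_re_R q (R p m)
  have h6 := re_L_eq_re_R (p * q) m
  simp only [map_add, map_sub] at h1 h2 h3
  have : (3 : ℝ) • re (A p q m) = 0 := by
    linear_combination (norm := module) -h1 + h2 - h3 - h4 - h5 + h6
  exact (smul_eq_zero.mp this).resolve_left three_ne_zero

theorem eq_zero_of_re {m : M} (h : ∀ p, re (L p m) = 0) : m = 0 := by
  rw [decomp m]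
  have h0 := h 1
  rw [one_L] at h0
  simp [h, h0]

theorem L_L_of_mem {z : M} (hz : z ∈ nucleus M) (p q : Octonion) :
    L p (L q z) = L (p * q) z := by
  rw [L_L, hz, sub_zero]

end OctBimodule

namespace OctBimodule
open Octonion
variable {M : Type u} [AddCommGroup M] [Module ℝ M] [OctBimodule M]
variable {X : Type v} [AddCommGroup X] [Module ℝ X] [OctBimodule X]
variable {Y : Type w} [AddCommGroup Y] [Module ℝ Y] [OctBimodule Y]

/-- The left associator `A_p(x, f) = f(p x) - p f(x)`. -/
noncomputable def lAssoc (p : Octonion) (f : M →ₗ[ℝ] X) : M →ₗ[ℝ] X := f ∘ₗ L p - L p ∘ₗ f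

/-- The right associator `B_p(f, x) = f(x) p - f(x p)`. -/
noncomputable def rAssoc (p : Octonion) (f : M →ₗ[ℝ] X) : M →ₗ[ℝ] X := R p ∘ₗ f - f ∘ₗ R p

theorem lAssoc_apply (p : Octonion) (f : M →ₗ[ℝ] X) (x : M) :
    lAssoc p f x = f (L p x) - L p (f x) := rfl
theorem rAssoc_apply (p : Octonion) (f : M →ₗ[ℝ] X) (x : M) :
    rAssoc p f x = R p (f x) - f (R p x) := rfl

variable (M X) in
/-- The left `𝕆`-para-linear maps. -/
def HomLO : Submodule ℝ (M →ₗ[ℝ] X) where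
  carrier := {f | ∀ p x, re (lAssoc p f x) = 0}
  add_mem' {f g} hf hg p x := by
    have h1 := hf p x
    have h2 := hg p x
    simp only [lAssoc_apply, map_sub, LinearMap.add_apply, map_add] at *
    linear_combination (norm := module) h1 + h2
  zero_mem' p x := by simp [lAssoc]
  smul_mem' r f hf p x := by
    have h1 := hf p x
    simp only [lAssoc_apply, map_sub, LinearMap.smul_apply, map_smul] at *
    linear_combination (norm := module) r • h1

variable (M X) in
/-- The right `𝕆`-para-linear maps. -/
def HomRO : Submodule ℝ (M →ₗ[ℝ] X) where
  carrier := {f | ∀ p x, re (rAssoc p f x) = 0}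
  add_mem' {f g} hf hg p x := by
    have h1 := hf p x
    have h2 := hg p x
    simp only [rAssoc_apply, map_sub, LinearMap.add_apply, map_add] at *
    linear_combination (norm := module) h1 + h2
  zero_mem' p x := by simp [rAssoc]
  smul_mem' r f hf p x := by
    have h1 := hf p x
    simp only [rAssoc_apply, map_sub, LinearMap.smul_apply, map_smul] at *
    linear_combination (norm := module) r • h1

/-- `(f ⊚ g)(x) = f(g(x)) - ∑ⱼ eⱼ Re f(A_{eⱼ}(x, g))`, the left regular composition. -/
noncomputable def lComp (f : X →ₗ[ℝ] Y) (g : M →ₗ[ℝ] X) : M →ₗ[ℝ] Y :=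
  f ∘ₗ g - ∑ j : Fin 7, L (e j.succ) ∘ₗ re ∘ₗ f ∘ₗ lAssoc (e j.succ) g

/-- `(f ⊚ g)(x) = f(g(x)) + ∑ⱼ (Re f(B_{eⱼ}(g, x))) eⱼ`, the right regular composition. -/
noncomputable def rComp (f : X →ₗ[ℝ] Y) (g : M →ₗ[ℝ] X) : M →ₗ[ℝ] Y :=
  f ∘ₗ g + ∑ j : Fin 7, R (e j.succ) ∘ₗ re ∘ₗ f ∘ₗ rAssoc (e j.succ) g

theorem lComp_apply (f : X →ₗ[ℝ] Y) (g : M →ₗ[ℝ] X) (x : M) :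
    lComp f g x = f (g x) - ∑ j : Fin 7, L (e j.succ) (re (f (lAssoc (e j.succ) g x))) := by
  simp [lComp]
theorem rComp_apply (f : X →ₗ[ℝ] Y) (g : M →ₗ[ℝ] X) (x : M) :
    rComp f g x = f (g x) + ∑ j : Fin 7, R (e j.succ) (re (f (rAssoc (e j.succ) g x))) := by
  simp [rComp]

/-- Linear maps are determined by their values on products `q z` with `z` associative. -/
theorem ext_mul {N : Type v} [AddCommGroup N] [Module ℝ N] {f g : M →ₗ[ℝ] N}
    (h : ∀ q, ∀ z ∈ nucleus M, f (L q z) = g (L q z)) : f = g := by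
  ext m
  have h0 := h 1 _ (re_mem m)
  rw [one_L] at h0
  rw [decomp m]
  simp only [map_sub, map_sum, h0, h _ _ (re_mem _)]

theorem re_L_L (p q : Octonion) (m : M) : re (L p (L q m)) = re (L (p * q) m) := by
  rw [L_L, map_sub, re_A, sub_zero]
theorem re_R_R (p q : Octonion) (m : M) : re (R q (R p m)) = re (R (p * q) m) := by
  rw [R_R, map_add, re_A, add_zero]
theorem R_R_of_mem {z : M} (hz : z ∈ nucleus M) (p q : Octonion) :
    R q (R p z) = R (p * q) z := by
  rw [R_R, hz, add_zero]
theorem L_mem_smul {z : M} (hz : z ∈ nucleus M) (p q : Octonion) :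
    R q (L p z) = L (p * q) z := by
  rw [R_L, hz, add_zero, ← L_eq_R_of_mem hz, L_L_of_mem hz]

theorem mem_HomLO_iff {f : M →ₗ[ℝ] X} :
    f ∈ HomLO M X ↔ ∀ p, ∀ x ∈ nucleus M, f (L p x) = L p (f x) := by
  constructor
  · intro hf p x hx
    rw [← sub_eq_zero]
    refine eq_zero_of_re fun q => ?_
    have h1 := hf q (L p x)
    have h2 := hf (q * p) x
    rw [lAssoc_apply, map_sub] at h1 h2
    rw [L_L_of_mem hx] at h1
    rw [map_sub, map_sub, re_L_L]
    linear_combination (norm := module) h2 - h1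
  · intro h p x
    have : re ∘ₗ lAssoc p f = 0 := ext_mul fun q z hz => by
      simp only [LinearMap.comp_apply, lAssoc_apply, map_sub, L_L_of_mem hz, h _ z hz, re_L_L]
      simp
    exact LinearMap.congr_fun this x

theorem mem_HomRO_iff {f : M →ₗ[ℝ] X} :
    f ∈ HomRO M X ↔ ∀ p, ∀ x ∈ nucleus M, f (R p x) = R p (f x) := by
  constructor
  · intro hf p x hx
    rw [← sub_eq_zero]
    refine eq_zero_of_re fun q => ?_
    have h1 := hf q (R p x)
    have h2 := hf (p * q) x
    rw [rAssoc_apply, map_sub] at h1 h2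
    rw [R_R_of_mem hx] at h1
    rw [re_L_eq_re_R, map_sub, map_sub, re_R_R]
    linear_combination (norm := module) h1 - h2
  · intro h p x
    have : re ∘ₗ rAssoc p f = 0 := ext_mul fun q z hz => by
      simp only [LinearMap.comp_apply, rAssoc_apply, map_sub, L_eq_R_of_mem hz, R_R_of_mem hz,
        h _ z hz, re_R_R]
      simp
    exact LinearMap.congr_fun this x

theorem HomLO_ext {f g : M →ₗ[ℝ] X} (hf : f ∈ HomLO M X) (hg : g ∈ HomLO M X)
    (h : ∀ x ∈ nucleus M, f x = g x) : f = g :=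
  ext_mul fun q z hz => by
    rw [mem_HomLO_iff.mp hf q z hz, mem_HomLO_iff.mp hg q z hz, h z hz]

theorem HomRO_ext {f g : M →ₗ[ℝ] X} (hf : f ∈ HomRO M X) (hg : g ∈ HomRO M X)
    (h : ∀ x ∈ nucleus M, f x = g x) : f = g :=
  ext_mul fun q z hz => by
    rw [L_eq_R_of_mem hz, mem_HomRO_iff.mp hf q z hz, mem_HomRO_iff.mp hg q z hz, h z hz]

theorem lAssoc_of_mem {f : M →ₗ[ℝ] X} (hf : f ∈ HomLO M X) (p : Octonion) {x : M}
    (hx : x ∈ nucleus M) : lAssoc p f x = 0 := by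
  rw [lAssoc_apply, mem_HomLO_iff.mp hf p x hx, sub_self]
theorem rAssoc_of_mem {f : M →ₗ[ℝ] X} (hf : f ∈ HomRO M X) (p : Octonion) {x : M}
    (hx : x ∈ nucleus M) : rAssoc p f x = 0 := by
  rw [rAssoc_apply, mem_HomRO_iff.mp hf p x hx, sub_self]

theorem lComp_of_mem (f : X →ₗ[ℝ] Y) {g : M →ₗ[ℝ] X} (hg : g ∈ HomLO M X) {x : M}
    (hx : x ∈ nucleus M) : lComp f g x = f (g x) := by
  simp [lComp_apply, lAssoc_of_mem hg _ hx]
theorem rComp_of_mem (f : X →ₗ[ℝ] Y) {g : M →ₗ[ℝ] X} (hg : g ∈ HomRO M X) {x : M}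
    (hx : x ∈ nucleus M) : rComp f g x = f (g x) := by
  simp [rComp_apply, rAssoc_of_mem hg _ hx]

theorem lAssoc_eq {f : M →ₗ[ℝ] X} (hf : f ∈ HomLO M X) (p : Octonion) (y : M) :
    lAssoc p f y = ∑ j : Fin 7, L (e j.succ) (re (f (A (e j.succ) p y))) := by
  have h : ∀ j : Fin 7, re (L (e j.succ) (lAssoc p f y)) = - re (f (A (e j.succ) p y)) := by
    intro j
    have h1 := hf (e j.succ) (L p y)
    have h2 := hf (e j.succ * p) y
    rw [lAssoc_apply, map_sub] at h1 h2
    rw [lAssoc_apply, map_sub, map_sub, re_L_L, A, map_sub, map_sub]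
    linear_combination (norm := module) h2 - h1
  rw [decomp (lAssoc p f y), hf p y]
  simp [h]

theorem rAssoc_eq {f : M →ₗ[ℝ] X} (hf : f ∈ HomRO M X) (p : Octonion) (y : M) :
    rAssoc p f y = ∑ j : Fin 7, R (e j.succ) (re (f (A p (e j.succ) y))) := by
  have h : ∀ j : Fin 7, re (L (e j.succ) (rAssoc p f y)) = - re (f (A p (e j.succ) y)) := by
    intro j
    have h1 := hf (e j.succ) (R p y)
    have h2 := hf (p * e j.succ) y
    rw [rAssoc_apply, map_sub] at h1 h2
    rw [re_L_eq_re_R, rAssoc_apply, map_sub, map_sub, re_R_R, A, assoc_left, map_sub, map_sub]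
    linear_combination (norm := module) h2 - h1
  rw [decomp (rAssoc p f y), hf p y]
  simp [h, L_re_eq_R_re]

theorem lComp_mem {f : X →ₗ[ℝ] Y} {g : M →ₗ[ℝ] X} (hf : f ∈ HomLO X Y) (hg : g ∈ HomLO M X) :
    lComp f g ∈ HomLO M Y := by
  rw [mem_HomLO_iff]
  intro p x hx
  have h := lAssoc_eq hf p (g x)
  have hA : ∀ j : Fin 7, lAssoc (e j.succ) g (L p x) = A (e j.succ) p (g x) := by
    intro j
    rw [lAssoc_apply, L_L_of_mem hx, mem_HomLO_iff.mp hg _ x hx, mem_HomLO_iff.mp hg _ x hx, A]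
  rw [lComp_of_mem f hg hx, lComp_apply]
  simp only [hA]
  rw [← h, mem_HomLO_iff.mp hg p x hx, lAssoc_apply]
  abel

theorem rComp_mem {f : X →ₗ[ℝ] Y} {g : M →ₗ[ℝ] X} (hf : f ∈ HomRO X Y) (hg : g ∈ HomRO M X) :
    rComp f g ∈ HomRO M Y := by
  rw [mem_HomRO_iff]
  intro p x hx
  have h := rAssoc_eq hf p (g x)
  have hA : ∀ j : Fin 7, rAssoc (e j.succ) g (R p x) = A p (e j.succ) (g x) := by
    intro j
    rw [rAssoc_apply, R_R_of_mem hx, mem_HomRO_iff.mp hg _ x hx, mem_HomRO_iff.mp hg _ x hx, A,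
      assoc_left]
  rw [rComp_of_mem f hg hx, rComp_apply]
  simp only [hA]
  rw [← h, mem_HomRO_iff.mp hg p x hx, rAssoc_apply]
  abel

theorem id_mem_HomLO : (LinearMap.id : M →ₗ[ℝ] M) ∈ HomLO M M := fun p x => by
  simp [lAssoc_apply]
theorem id_mem_HomRO : (LinearMap.id : M →ₗ[ℝ] M) ∈ HomRO M M := fun p x => by
  simp [rAssoc_apply]
theorem lComp_id (f : M →ₗ[ℝ] X) : lComp f LinearMap.id = f := by
  ext x; simp [lComp_apply, lAssoc_apply]
theorem rComp_id (f : M →ₗ[ℝ] X) : rComp f LinearMap.id = f := by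
  ext x; simp [rComp_apply, rAssoc_apply]
theorem id_lComp {f : M →ₗ[ℝ] X} (hf : f ∈ HomLO M X) : lComp LinearMap.id f = f := by
  ext x; simp [lComp_apply, hf _ x]
theorem id_rComp {f : M →ₗ[ℝ] X} (hf : f ∈ HomRO M X) : rComp LinearMap.id f = f := by
  ext x; simp [rComp_apply, hf _ x]

/-- The left multiplication `(r ⊙ f)(x) = f(x r) + A_r(x, f)`. -/
noncomputable def lSmul (r : Octonion) (f : M →ₗ[ℝ] X) : M →ₗ[ℝ] X := f ∘ₗ R r + lAssoc r f

/-- The right multiplication `(f ⊙ r)(x) = f(x) r - A_r(x, f)`. -/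
noncomputable def rSmul (r : Octonion) (f : M →ₗ[ℝ] X) : M →ₗ[ℝ] X := R r ∘ₗ f - lAssoc r f

theorem lSmul_apply (r : Octonion) (f : M →ₗ[ℝ] X) (x : M) :
    lSmul r f x = f (R r x) + lAssoc r f x := rfl
theorem rSmul_apply (r : Octonion) (f : M →ₗ[ℝ] X) (x : M) :
    rSmul r f x = R r (f x) - lAssoc r f x := rfl

theorem lSmul_of_mem {f : M →ₗ[ℝ] X} (hf : f ∈ HomLO M X) (r : Octonion) {x : M}
    (hx : x ∈ nucleus M) : lSmul r f x = L r (f x) := by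
  rw [lSmul_apply, lAssoc_of_mem hf r hx, add_zero, ← L_eq_R_of_mem hx,
    mem_HomLO_iff.mp hf r x hx]
theorem rSmul_of_mem {f : M →ₗ[ℝ] X} (hf : f ∈ HomLO M X) (r : Octonion) {x : M}
    (hx : x ∈ nucleus M) : rSmul r f x = R r (f x) := by
  rw [rSmul_apply, lAssoc_of_mem hf r hx, sub_zero]

theorem lSmul_mem {f : M →ₗ[ℝ] X} (hf : f ∈ HomLO M X) (r : Octonion) :
    lSmul r f ∈ HomLO M X := by
  rw [mem_HomLO_iff]
  intro p x hx
  have h := mem_HomLO_iff.mp hf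
  rw [lSmul_of_mem hf r hx, lSmul_apply, lAssoc_apply, L_mem_smul hx, L_L_of_mem hx,
    h _ x hx, h _ x hx, h _ x hx]
  have h1 := A_skew r p (f x)
  simp only [A] at h1
  linear_combination (norm := module) h1

theorem rSmul_mem {f : M →ₗ[ℝ] X} (hf : f ∈ HomLO M X) (r : Octonion) :
    rSmul r f ∈ HomLO M X := by
  rw [mem_HomLO_iff]
  intro p x hx
  have h := mem_HomLO_iff.mp hf
  rw [rSmul_of_mem hf r hx, rSmul_apply, lAssoc_apply, L_L_of_mem hx,
    h _ x hx, h _ x hx, R_L, A]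
  abel

/-- The `𝕆`-bimodule structure on the space of left para-linear maps. -/
noncomputable instance : OctBimodule (HomLO M X) where
  L := LinearMap.mk₂ ℝ (fun r f => ⟨lSmul r f.1, lSmul_mem f.2 r⟩)
    (fun r s f => by
      ext x
      simp only [lSmul_apply, lAssoc_apply, map_add, LinearMap.add_apply, Submodule.coe_add]
      abel)
    (fun c r f => by
      ext x
      simp [lSmul_apply, lAssoc_apply, smul_sub])
    (fun r f g => by
      ext x
      simp only [lSmul_apply, lAssoc_apply, map_add, LinearMap.add_apply, Submodule.coe_add]
      abel)
    (fun c r f => by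
      ext x
      simp [lSmul_apply, lAssoc_apply, smul_sub])
  R := LinearMap.mk₂ ℝ (fun r f => ⟨rSmul r f.1, rSmul_mem f.2 r⟩)
    (fun r s f => by
      ext x
      simp only [rSmul_apply, lAssoc_apply, map_add, LinearMap.add_apply, Submodule.coe_add]
      abel)
    (fun c r f => by
      ext x
      simp [rSmul_apply, lAssoc_apply, smul_sub])
    (fun r f g => by
      ext x
      simp only [rSmul_apply, lAssoc_apply, map_add, LinearMap.add_apply, Submodule.coe_add]
      abel)
    (fun c r f => by
      ext x
      simp [rSmul_apply, lAssoc_apply, smul_sub])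
  one_L f := by
    ext x
    simp [lSmul_apply, lAssoc_apply, one_L, R_one]
  R_one f := by
    ext x
    simp [rSmul_apply, lAssoc_apply, one_L, R_one]
  left_alt p q f := by
    refine Subtype.ext (HomLO_ext (SetLike.coe_mem _) (SetLike.coe_mem _) fun x hx => ?_)
    simpa [lSmul_of_mem f.2 _ hx, lSmul_of_mem (lSmul_mem f.2 _) _ hx]
      using left_alt p q (f.1 x)
  assoc_left p q f := by
    refine Subtype.ext (HomLO_ext (SetLike.coe_mem _) (SetLike.coe_mem _) fun x hx => ?_)
    simpa [lSmul_of_mem f.2 _ hx, lSmul_of_mem (lSmul_mem f.2 _) _ hx,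
      rSmul_of_mem f.2 _ hx, rSmul_of_mem (rSmul_mem f.2 _) _ hx]
      using assoc_left p q (f.1 x)
  assoc_mid p q f := by
    refine Subtype.ext (HomLO_ext (SetLike.coe_mem _) (SetLike.coe_mem _) fun x hx => ?_)
    simpa [rSmul_of_mem f.2 _ hx, rSmul_of_mem (rSmul_mem f.2 _) _ hx,
      lSmul_of_mem (rSmul_mem f.2 _) _ hx, rSmul_of_mem (lSmul_mem f.2 _) _ hx,
      lSmul_of_mem f.2 _ hx] using assoc_mid p q (f.1 x)

theorem coe_L (r : Octonion) (f : HomLO M X) : (L r f).1 = lSmul r f.1 := rfl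
theorem coe_R (r : Octonion) (f : HomLO M X) : (R r f).1 = rSmul r f.1 := rfl

theorem coe_re (f : HomLO M X) {x : M} (hx : x ∈ nucleus M) : (re f).1 x = re (f.1 x) := by
  rw [re_apply, re_apply]
  simp [coe_L, coe_R, lSmul_of_mem (rSmul_mem f.2 _) _ hx, rSmul_of_mem f.2 _ hx]

theorem apply_mem {g : HomLO M X} (hg : g ∈ nucleus (HomLO M X)) {x : M}
    (hx : x ∈ nucleus M) : g.1 x ∈ nucleus X := by
  rw [← re_eq_self hg, coe_re g hx]
  exact re_mem _

theorem apply_re {g : HomLO M X} (hg : g ∈ nucleus (HomLO M X)) (m : M) :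
    re (g.1 m) = g.1 (re m) := by
  have : re ∘ₗ g.1 = g.1 ∘ₗ re := ext_mul fun q z hz => by
    simp [mem_HomLO_iff.mp g.2 q z hz, re_L_of_mem hz, re_L_of_mem (apply_mem hg hz)]
  exact LinearMap.congr_fun this m

theorem lAssoc_of_nucleus {g : HomLO M X} (hg : g ∈ nucleus (HomLO M X)) (p : Octonion) (y : M) :
    lAssoc p g.1 y = 0 := by
  simp [lAssoc_eq g.2, apply_re hg, re_A]

end OctBimodule

namespace OctBimodule
open Octonion
section
variable {M : Type u} [AddCommGroup M] [Module ℝ M] [OctBimodule M]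
variable {X : Type u} [AddCommGroup X] [Module ℝ X] [OctBimodule X]
variable {Y : Type u} [AddCommGroup Y] [Module ℝ Y] [OctBimodule Y]
variable {Z : Type u} [AddCommGroup Z] [Module ℝ Z] [OctBimodule Z]

theorem lComp_add (f : X →ₗ[ℝ] Y) (g h : M →ₗ[ℝ] X) :
    lComp f (g + h) = lComp f g + lComp f h := by
  ext x
  have : ∀ j : Fin 7, lAssoc (e j.succ) (g + h) x
      = lAssoc (e j.succ) g x + lAssoc (e j.succ) h x := fun j => by
    simp only [lAssoc_apply, LinearMap.add_apply, map_add]; abel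
  simp only [lComp_apply, LinearMap.add_apply, map_add, this, Finset.sum_add_distrib]
  abel
theorem lComp_smul (c : ℝ) (f : X →ₗ[ℝ] Y) (g : M →ₗ[ℝ] X) :
    lComp f (c • g) = c • lComp f g := by
  ext x
  have : ∀ j : Fin 7, lAssoc (e j.succ) (c • g) x = c • lAssoc (e j.succ) g x := fun j => by
    simp only [lAssoc_apply, LinearMap.smul_apply, map_smul, smul_sub]
  simp only [lComp_apply, LinearMap.smul_apply, map_smul, this, smul_sub, Finset.smul_sum]
theorem add_lComp (f g : X →ₗ[ℝ] Y) (h : M →ₗ[ℝ] X) :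
    lComp (f + g) h = lComp f h + lComp g h := by
  ext x
  simp only [lComp_apply, LinearMap.add_apply, map_add, Finset.sum_add_distrib]
  abel
theorem smul_lComp (c : ℝ) (f : X →ₗ[ℝ] Y) (g : M →ₗ[ℝ] X) :
    lComp (c • f) g = c • lComp f g := by
  ext x
  simp only [lComp_apply, LinearMap.smul_apply, map_smul, smul_sub, Finset.smul_sum]

variable (M) in
/-- Post-composition `g ↦ f ⊚ g`. -/
noncomputable def postComp (f : HomLO X Y) : HomLO M X →ₗ[ℝ] HomLO M Y where
  toFun g := ⟨lComp f.1 g.1, lComp_mem f.2 g.2⟩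
  map_add' _ _ := Subtype.ext (lComp_add _ _ _)
  map_smul' _ _ := Subtype.ext (lComp_smul _ _ _)

variable (M) in
/-- Pre-composition `g ↦ g ⊚ f`. -/
noncomputable def preComp (f : HomLO X Y) : HomLO Y M →ₗ[ℝ] HomLO X M where
  toFun g := ⟨lComp g.1 f.1, lComp_mem g.2 f.2⟩
  map_add' _ _ := Subtype.ext (add_lComp _ _ _)
  map_smul' _ _ := Subtype.ext (smul_lComp _ _ _)

theorem postComp_apply (f : HomLO X Y) (g : HomLO M X) : (postComp M f g).1 = lComp f.1 g.1 := rfl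
theorem preComp_apply (f : HomLO X Y) (g : HomLO Y M) : (preComp M f g).1 = lComp g.1 f.1 := rfl

theorem postComp_mem (f : HomLO X Y) : postComp M f ∈ HomLO (HomLO M X) (HomLO M Y) := by
  rw [mem_HomLO_iff]
  intro p g hg
  refine Subtype.ext (HomLO_ext (SetLike.coe_mem _) (SetLike.coe_mem _) fun x hx => ?_)
  rw [postComp_apply, lComp_of_mem _ (SetLike.coe_mem _) hx, coe_L, lSmul_of_mem g.2 p hx, coe_L,
    lSmul_of_mem (SetLike.coe_mem _) p hx, postComp_apply, lComp_of_mem _ g.2 hx,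
    mem_HomLO_iff.mp f.2 p _ (apply_mem hg hx)]

theorem preComp_mem (f : HomLO X Y) : preComp M f ∈ HomRO (HomLO Y M) (HomLO X M) := by
  rw [mem_HomRO_iff]
  intro p g hg
  refine Subtype.ext (HomLO_ext (SetLike.coe_mem _) (SetLike.coe_mem _) fun x hx => ?_)
  rw [preComp_apply, lComp_of_mem _ f.2 hx, coe_R, rSmul_apply, lAssoc_of_nucleus hg, coe_R,
    rSmul_of_mem (SetLike.coe_mem _) p hx, preComp_apply, lComp_of_mem _ f.2 hx, sub_zero]

theorem postComp_id (g : HomLO M X) : postComp M ⟨LinearMap.id, id_mem_HomLO⟩ g = g :=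
  Subtype.ext (id_lComp g.2)
theorem preComp_id (g : HomLO X M) : preComp M ⟨LinearMap.id, id_mem_HomLO⟩ g = g :=
  Subtype.ext (lComp_id g.1)

theorem postComp_lComp (f : HomLO X Y) (h : HomLO Y Z) :
    postComp M ⟨lComp h.1 f.1, lComp_mem h.2 f.2⟩ = lComp (postComp M h) (postComp M f) := by
  refine HomLO_ext (postComp_mem _) (lComp_mem (postComp_mem h) (postComp_mem f)) fun g hg => ?_
  rw [lComp_of_mem _ (postComp_mem f) hg]
  refine Subtype.ext (HomLO_ext (SetLike.coe_mem _) (SetLike.coe_mem _) fun x hx => ?_)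
  simp only [postComp_apply]
  rw [lComp_of_mem _ g.2 hx, lComp_of_mem _ (lComp_mem f.2 g.2) hx, lComp_of_mem _ g.2 hx,
    lComp_of_mem _ f.2 (apply_mem hg hx)]

theorem preComp_lComp (f : HomLO X Y) (h : HomLO Y Z) :
    preComp M ⟨lComp h.1 f.1, lComp_mem h.2 f.2⟩ = rComp (preComp M f) (preComp M h) := by
  refine HomRO_ext (preComp_mem _) (rComp_mem (preComp_mem f) (preComp_mem h)) fun g hg => ?_
  rw [rComp_of_mem _ (preComp_mem h) hg]
  refine Subtype.ext (HomLO_ext (SetLike.coe_mem _) (SetLike.coe_mem _) fun x hx => ?_)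
  have h0 : ∀ (p : Octonion) (y : Y), re (lAssoc p h.1 y) = 0 := h.2
  simp only [preComp_apply]
  rw [lComp_of_mem _ (lComp_mem h.2 f.2) hx, lComp_of_mem _ f.2 hx, lComp_of_mem _ f.2 hx,
    lComp_apply]
  simp [apply_re hg, h0]
end

end OctBimodule

namespace Octonion
/-- The conjugate octonion. -/
noncomputable def conj (p : Octonion) : Octonion :=
  fun i => if i = 0 then p i else -p i
end Octonion

/-- The `𝕆`-bimodule `V ⊗_ℝ 𝕆` of a real vector space `V`. -/
def OctExt (V : Type u) [AddCommGroup V] [Module ℝ V] : Type u := V ⊗[ℝ] Octonion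

namespace OctExt
variable {V : Type u} [AddCommGroup V] [Module ℝ V]

noncomputable instance : AddCommGroup (OctExt V) := inferInstanceAs (AddCommGroup (V ⊗[ℝ] Octonion))
noncomputable instance : Module ℝ (OctExt V) := inferInstanceAs (Module ℝ (V ⊗[ℝ] Octonion))

/-- `v ⊗ p` -/
noncomputable def mk : V →ₗ[ℝ] Octonion →ₗ[ℝ] OctExt V := TensorProduct.mk ℝ V Octonion

theorem hom_ext {N : Type v} [AddCommGroup N] [Module ℝ N] {f g : OctExt V →ₗ[ℝ] N}
    (h : ∀ v p, f (mk v p) = g (mk v p)) : f = g :=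
  TensorProduct.ext' (M := V) (N := Octonion) h

/-- The linear map with `v ⊗ p ↦ f v p`. -/
noncomputable def lift {N : Type v} [AddCommGroup N] [Module ℝ N] (f : V →ₗ[ℝ] Octonion →ₗ[ℝ] N) :
    OctExt V →ₗ[ℝ] N := TensorProduct.lift f
theorem lift_mk {N : Type v} [AddCommGroup N] [Module ℝ N] (f : V →ₗ[ℝ] Octonion →ₗ[ℝ] N)
    (v : V) (p : Octonion) : lift f (mk v p) = f v p := rfl

/-- `p (v ⊗ q) = v ⊗ p q` -/
noncomputable def lmul : Octonion →ₗ[ℝ] OctExt V →ₗ[ℝ] OctExt V :=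
  LinearMap.lTensorHom V ∘ₗ LinearMap.mul ℝ Octonion
/-- `(v ⊗ q) p = v ⊗ q p` -/
noncomputable def rmul : Octonion →ₗ[ℝ] OctExt V →ₗ[ℝ] OctExt V :=
  LinearMap.lTensorHom V ∘ₗ (LinearMap.mul ℝ Octonion).flip
theorem lmul_mk (p q : Octonion) (v : V) : lmul p (mk v q) = mk v (p * q) := rfl
theorem rmul_mk (p q : Octonion) (v : V) : rmul p (mk v q) = mk v (q * p) := rfl

noncomputable instance : OctBimodule (OctExt V) where
  L := lmul
  R := rmul
  one_L t := by
    have : lmul 1 = (LinearMap.id : OctExt V →ₗ[ℝ] OctExt V) := hom_ext fun v r => by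
      rw [lmul_mk, one_mul, LinearMap.id_apply]
    rw [this, LinearMap.id_apply]
  R_one t := by
    have : rmul 1 = (LinearMap.id : OctExt V →ₗ[ℝ] OctExt V) := hom_ext fun v r => by
      rw [rmul_mk, mul_one, LinearMap.id_apply]
    rw [this, LinearMap.id_apply]
  left_alt p q t := by
    have : (lmul (p * q) - lmul p ∘ₗ lmul q : OctExt V →ₗ[ℝ] OctExt V)
        = -(lmul (q * p) - lmul q ∘ₗ lmul p) := hom_ext fun v r => by
      simp only [LinearMap.sub_apply, LinearMap.neg_apply, LinearMap.comp_apply, lmul_mk,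
        ← map_sub, ← map_neg]
      rw [Octonion.left_alt]
    exact LinearMap.congr_fun this t
  assoc_left p q t := by
    have : (lmul (p * q) - lmul p ∘ₗ lmul q : OctExt V →ₗ[ℝ] OctExt V)
        = rmul q ∘ₗ rmul p - rmul (p * q) := hom_ext fun v r => by
      simp only [LinearMap.sub_apply, LinearMap.comp_apply, lmul_mk, rmul_mk, ← map_sub]
      rw [Octonion.assoc_left]
    exact LinearMap.congr_fun this t
  assoc_mid p q t := by
    have : (rmul q ∘ₗ rmul p - rmul (p * q) : OctExt V →ₗ[ℝ] OctExt V)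
        = rmul p ∘ₗ lmul q - lmul q ∘ₗ rmul p := hom_ext fun v r => by
      simp only [LinearMap.sub_apply, LinearMap.comp_apply, lmul_mk, rmul_mk, ← map_sub]
      rw [Octonion.assoc_mid]
    exact LinearMap.congr_fun this t

end OctExt

namespace OctBimodule
open Octonion
variable {V : Type u} [AddCommGroup V] [Module ℝ V]
variable {M : Type u} [AddCommGroup M] [Module ℝ M] [OctBimodule M]
variable {X : Type u} [AddCommGroup X] [Module ℝ X] [OctBimodule X]
variable {Y : Type u} [AddCommGroup Y] [Module ℝ Y] [OctBimodule Y]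
variable {Z : Type u} [AddCommGroup Z] [Module ℝ Z] [OctBimodule Z]

theorem L_mk (p q : Octonion) (v : V) : L p (OctExt.mk v q) = OctExt.mk v (p * q) := rfl
theorem R_mk (p q : Octonion) (v : V) : R p (OctExt.mk v q) = OctExt.mk v (q * p) := rfl

theorem mk_one_mem (v : V) : OctExt.mk v 1 ∈ nucleus (OctExt V) := by
  intro p q
  simp [A, L_mk]

theorem re_mk (v : V) (p : Octonion) : re (OctExt.mk v p) = OctExt.mk (p 0 • v) 1 := by
  have h := re_L_of_mem (mk_one_mem v) p
  rw [L_mk, mul_one] at h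
  rw [h, map_smul, LinearMap.smul_apply]

/-- The real part of `V ⊗ 𝕆` is `V ⊗ 1`. -/
theorem mem_nucleus_octExt (w : OctExt V) :
    w ∈ nucleus (OctExt V) ↔ ∃ v, w = OctExt.mk v 1 := by
  constructor
  · intro hw
    have h : (re : OctExt V →ₗ[ℝ] OctExt V) =
        OctExt.mk.flip 1 ∘ₗ OctExt.lift (LinearMap.mk₂ ℝ (fun v (p : Octonion) => p 0 • v)
          (fun _ _ _ => smul_add _ _ _) (fun _ _ _ => smul_comm _ _ _)
          (fun _ _ _ => add_smul _ _ _) (fun _ _ _ => mul_smul _ _ _)) :=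
      OctExt.hom_ext fun v p => by rw [re_mk]; rfl
    exact ⟨_, (re_eq_self hw).symm.trans (LinearMap.congr_fun h w)⟩
  · rintro ⟨v, rfl⟩
    exact mk_one_mem v

/-- The real coordinates `mᵢ = Re (ēᵢ m)` in `m = ∑ᵢ eᵢ mᵢ`. -/
noncomputable def coord (i : Fin 8) : M →ₗ[ℝ] nucleus M :=
  (re ∘ₗ L (conj (e i))).codRestrict (nucleus M) fun _ => re_mem _

theorem coord_apply (i : Fin 8) (m : M) : (coord i m : M) = re (L (conj (e i)) m) := rfl

theorem eq_sum_coord (m : M) : m = ∑ i : Fin 8, L (e i) (coord i m : M) := by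
  have h0 : conj 1 = 1 := by
    apply ext8 <;> simp [conj, one_def, e_apply]
  have h1 : ∀ i : Fin 7, conj (e i.succ) = - e i.succ := by
    intro i
    ext j
    simp only [conj, neg_apply, e_apply]
    split_ifs with h2 h3
    · exact absurd (h2.symm.trans h3).symm (Fin.succ_ne_zero i)
    all_goals simp
  have h := decomp m
  rw [Fin.sum_univ_succ]
  simp only [coord_apply, h0, h1, map_neg, LinearMap.neg_apply, Finset.sum_neg_distrib,
    ← one_def, one_L]
  rw [← sub_eq_add_neg]
  exact h

theorem coord_L (i : Fin 8) (p : Octonion) {z : M} (hz : z ∈ nucleus M) :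
    coord i (L p z) = p i • (⟨z, hz⟩ : nucleus M) := by
  apply Subtype.ext
  rw [coord_apply, L_L_of_mem hz, re_L_of_mem hz]
  have : (conj (e i) * p) 0 = p i := by
    fin_cases i <;> simp [conj, e_apply]
  rw [this]; rfl

/-- `m ⊗_𝕆 m' = ∑ᵢⱼ (mᵢ ⊗ m'ⱼ) ⊗ eᵢ eⱼ` in `(Re M ⊗ Re X) ⊗ 𝕆`. -/
noncomputable def octTmul : M →ₗ[ℝ] X →ₗ[ℝ] OctExt (nucleus M ⊗[ℝ] nucleus X) :=
  LinearMap.mk₂ ℝ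
    (fun m m' => ∑ i : Fin 8, ∑ j : Fin 8, OctExt.mk (coord i m ⊗ₜ[ℝ] coord j m') (e i * e j))
    (fun m n x => by
      simp only [map_add, TensorProduct.add_tmul, LinearMap.add_apply, Finset.sum_add_distrib])
    (fun c m x => by
      simp only [map_smul, ← TensorProduct.smul_tmul', LinearMap.smul_apply, Finset.smul_sum])
    (fun m x y => by
      simp only [map_add, TensorProduct.tmul_add, LinearMap.add_apply, Finset.sum_add_distrib])
    (fun c m x => by
      simp only [map_smul, TensorProduct.tmul_smul, LinearMap.smul_apply, Finset.smul_sum])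

theorem octTmul_apply (m : M) (x : X) : octTmul m x =
    ∑ i : Fin 8, ∑ j : Fin 8, OctExt.mk (coord i m ⊗ₜ[ℝ] coord j x) (e i * e j) := rfl

/-- The map `f_M : Re M ⊗ Re X → M ⊗_𝕆 Y`, `m ⊗ x ↦ m ⊗_𝕆 f(x)`. -/
noncomputable def tensorAux (M : Type u) [AddCommGroup M] [Module ℝ M] [OctBimodule M]
    (f : X →ₗ[ℝ] Y) : nucleus M ⊗[ℝ] nucleus X →ₗ[ℝ] OctExt (nucleus M ⊗[ℝ] nucleus Y) :=
  TensorProduct.lift (octTmul.compl₁₂ (nucleus M).subtype (f ∘ₗ (nucleus X).subtype))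

theorem tensorAux_tmul (f : X →ₗ[ℝ] Y) (m : nucleus M) (x : nucleus X) :
    tensorAux M f (m ⊗ₜ[ℝ] x) = octTmul (m : M) (f x) := by
  rw [tensorAux, TensorProduct.lift.tmul, LinearMap.compl₁₂_apply]
  simp only [Submodule.coe_subtype, LinearMap.comp_apply]

/-- The left para-linear extension to `V ⊗ 𝕆` of a real linear map on `V = Re (V ⊗ 𝕆)`:
`v ⊗ p ↦ p φ(v)`. -/
noncomputable def lExt (φ : V →ₗ[ℝ] X) : OctExt V →ₗ[ℝ] X := OctExt.lift (L.flip ∘ₗ φ)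

theorem lExt_mk (φ : V →ₗ[ℝ] X) (v : V) (p : Octonion) :
    lExt φ (OctExt.mk v p) = L p (φ v) := rfl

theorem lExt_mem (φ : V →ₗ[ℝ] X) : lExt φ ∈ HomLO (OctExt V) X := by
  intro p t
  have h : re ∘ₗ lAssoc p (lExt φ) = 0 := by
    refine OctExt.hom_ext fun v q => ?_
    rw [LinearMap.comp_apply, lAssoc_apply, L_mk, lExt_mk, lExt_mk]
    exact re_A p q (φ v)
  exact LinearMap.congr_fun h t

/-- The map `1_M ⊗ f : M ⊗_𝕆 X → M ⊗_𝕆 Y`. -/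
noncomputable def tensorMap (M : Type u) [AddCommGroup M] [Module ℝ M] [OctBimodule M]
    (f : X →ₗ[ℝ] Y) :
    OctExt (nucleus M ⊗[ℝ] nucleus X) →ₗ[ℝ] OctExt (nucleus M ⊗[ℝ] nucleus Y) :=
  lExt (tensorAux M f)

theorem tensorMap_mem (f : X →ₗ[ℝ] Y) : tensorMap M f ∈
    HomLO (OctExt (nucleus M ⊗[ℝ] nucleus X)) (OctExt (nucleus M ⊗[ℝ] nucleus Y)) :=
  lExt_mem _

theorem octTmul_L_of_mem (m : nucleus M) (x : nucleus X) (p : Octonion) :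
    octTmul (m : M) (L p (x : X)) = OctExt.mk (m ⊗ₜ[ℝ] x) p := by
  have h1 : ∀ i : Fin 8, coord i (m : M) = (e 0 i : ℝ) • m := by
    intro i
    have := coord_L i 1 m.2
    rwa [one_L] at this
  have h2 : ∀ j : Fin 8, coord j (L p (x : X)) = p j • x := fun j => coord_L j p x.2
  have h3 : p = ∑ j : Fin 8, p j • (e 0 * e j) := by
    simp only [← one_def, one_mul]
    rw [Fin.sum_univ_succ (f := fun j => p j • e j)]
    exact eq_sum p
  rw [octTmul_apply, Finset.sum_eq_single 0]
  · conv_rhs => rw [h3, map_sum]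
    refine Finset.sum_congr rfl fun j _ => ?_
    rw [h1, h2, e_apply, if_pos rfl, one_smul, TensorProduct.tmul_smul, map_smul, map_smul,
      LinearMap.smul_apply]
  · intro i _ hi
    simp [h1, e_apply, hi]
  · simp

theorem octTmul_L (m : nucleus M) (y : X) (p : Octonion) :
    octTmul (m : M) (L p y) = L p (octTmul (m : M) y) := by
  have : octTmul (m : M) ∘ₗ L p = L p ∘ₗ octTmul (X := X) (m : M) := ext_mul fun q z hz => by
    rw [LinearMap.comp_apply, LinearMap.comp_apply, L_L_of_mem hz,
      octTmul_L_of_mem m ⟨z, hz⟩, octTmul_L_of_mem m ⟨z, hz⟩, L_mk]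
  exact LinearMap.congr_fun this y

theorem tensorMap_octTmul {f : X →ₗ[ℝ] Y} (hf : f ∈ HomLO X Y) (m : nucleus M) (y : X) :
    tensorMap M f (octTmul (m : M) y) = octTmul (m : M) (f y) := by
  have : tensorMap M f ∘ₗ octTmul (m : M) = octTmul (m : M) ∘ₗ f := ext_mul fun q z hz => by
    rw [LinearMap.comp_apply, LinearMap.comp_apply, octTmul_L_of_mem m ⟨z, hz⟩, tensorMap,
      lExt_mk, tensorAux_tmul, mem_HomLO_iff.mp hf q z hz, octTmul_L]
  exact LinearMap.congr_fun this y

theorem tensorMap_mk_one (f : X →ₗ[ℝ] Y) (m : nucleus M) (x : nucleus X) :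
    tensorMap M f (OctExt.mk (m ⊗ₜ[ℝ] x) 1) = octTmul (m : M) (f x) := by
  rw [tensorMap, lExt_mk, tensorAux_tmul, one_L]

theorem tensor_ext {N : Type v} [AddCommGroup N] [Module ℝ N] [OctBimodule N]
    {f g : OctExt (nucleus M ⊗[ℝ] nucleus X) →ₗ[ℝ] N}
    (hf : f ∈ HomLO _ N) (hg : g ∈ HomLO _ N)
    (h : ∀ (m : nucleus M) (x : nucleus X),
      f (OctExt.mk (m ⊗ₜ[ℝ] x) 1) = g (OctExt.mk (m ⊗ₜ[ℝ] x) 1)) : f = g := by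
  refine HomLO_ext hf hg fun w hw => ?_
  obtain ⟨t, rfl⟩ := (mem_nucleus_octExt w).mp hw
  have : f ∘ₗ OctExt.mk.flip 1 = g ∘ₗ OctExt.mk.flip 1 := TensorProduct.ext' h
  exact LinearMap.congr_fun this t

theorem tensorMap_id : tensorMap M (LinearMap.id : X →ₗ[ℝ] X) = LinearMap.id := by
  refine tensor_ext (tensorMap_mem _) id_mem_HomLO fun m x => ?_
  rw [tensorMap_mk_one]
  have := octTmul_L_of_mem m x 1
  rwa [one_L] at this

theorem tensorMap_lComp {f : X →ₗ[ℝ] Y} {h : Y →ₗ[ℝ] Z} (hf : f ∈ HomLO X Y)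
    (hh : h ∈ HomLO Y Z) :
    tensorMap M (lComp h f) = lComp (tensorMap M h) (tensorMap M f) := by
  refine tensor_ext (tensorMap_mem _) (lComp_mem (tensorMap_mem h) (tensorMap_mem f))
    fun m x => ?_
  rw [lComp_of_mem _ (tensorMap_mem f) (mk_one_mem _), tensorMap_mk_one, tensorMap_mk_one,
    tensorMap_octTmul hh, lComp_of_mem _ hf x.2]

end OctBimodule

namespace OctBimodule
variable {M : Type u} [AddCommGroup M] [Module ℝ M] [OctBimodule M]
variable {X : Type u} [AddCommGroup X] [Module ℝ X] [OctBimodule X]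
variable {Y : Type u} [AddCommGroup Y] [Module ℝ Y] [OctBimodule Y]
variable {Z : Type u} [AddCommGroup Z] [Module ℝ Z] [OctBimodule Z]

/-- The left regular composition of left para-linear maps. -/
noncomputable def compLO (f : HomLO X Y) (g : HomLO M X) : HomLO M Y :=
  ⟨lComp f.1 g.1, lComp_mem f.2 g.2⟩
/-- The right regular composition of right para-linear maps. -/
noncomputable def compRO (f : HomRO X Y) (g : HomRO M X) : HomRO M Y :=
  ⟨rComp f.1 g.1, rComp_mem f.2 g.2⟩
variable (M) in
/-- The identity in `𝓛𝕆`. -/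
def idLO : HomLO M M := ⟨LinearMap.id, id_mem_HomLO⟩
variable (M) in
/-- The identity in `𝓡𝕆`. -/
def idRO : HomRO M M := ⟨LinearMap.id, id_mem_HomRO⟩

variable (M) in
/-- `g ↦ f ⊚ g` as a left para-linear map `Hom(M, X) → Hom(M, Y)`. -/
noncomputable def homMap (f : HomLO X Y) : HomLO (HomLO M X) (HomLO M Y) :=
  ⟨postComp M f, postComp_mem f⟩
variable (M) in
/-- `g ↦ g ⊚ f` as a right para-linear map `Hom(Y, M) → Hom(X, M)`. -/
noncomputable def contraHomMap (f : HomLO X Y) : HomRO (HomLO Y M) (HomLO X M) :=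
  ⟨preComp M f, preComp_mem f⟩
variable (M) in
/-- `1 ⊗ f` as a left para-linear map `M ⊗_𝕆 X → M ⊗_𝕆 Y`. -/
noncomputable def tensorHom (f : HomLO X Y) :
    HomLO (OctExt (nucleus M ⊗[ℝ] nucleus X)) (OctExt (nucleus M ⊗[ℝ] nucleus Y)) :=
  ⟨tensorMap M f.1, tensorMap_mem f.1⟩

theorem coe_compLO (f : HomLO X Y) (g : HomLO M X) : (compLO f g).1 = lComp f.1 g.1 := rfl
theorem coe_compRO (f : HomRO X Y) (g : HomRO M X) : (compRO f g).1 = rComp f.1 g.1 := rfl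
theorem coe_homMap (f : HomLO X Y) : (homMap M f).1 = postComp M f := rfl
theorem coe_contraHomMap (f : HomLO X Y) : (contraHomMap M f).1 = preComp M f := rfl
theorem coe_tensorHom (f : HomLO X Y) : (tensorHom M f).1 = tensorMap M f.1 := rfl

theorem homMap_comp (g : HomLO Y Z) (f : HomLO X Y) :
    homMap M (compLO g f) = compLO (homMap M g) (homMap M f) := by
  apply Subtype.ext
  rw [coe_compLO, coe_homMap, coe_homMap, coe_homMap, ← postComp_lComp, compLO]
theorem contraHomMap_comp (g : HomLO Y Z) (f : HomLO X Y) :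
    contraHomMap M (compLO g f) = compRO (contraHomMap M f) (contraHomMap M g) := by
  apply Subtype.ext
  rw [coe_compRO, coe_contraHomMap, coe_contraHomMap, coe_contraHomMap, ← preComp_lComp, compLO]
theorem tensorHom_comp (g : HomLO Y Z) (f : HomLO X Y) :
    tensorHom M (compLO g f) = compLO (tensorHom M g) (tensorHom M f) := by
  apply Subtype.ext
  rw [coe_compLO, coe_tensorHom, coe_tensorHom, coe_tensorHom, coe_compLO,
    tensorMap_lComp f.2 g.2]
theorem homMap_id : homMap M (idLO X) = idLO (HomLO M X) :=
  Subtype.ext (LinearMap.ext postComp_id)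
theorem contraHomMap_id : contraHomMap M (idLO X) = idRO (HomLO X M) :=
  Subtype.ext (LinearMap.ext preComp_id)
theorem tensorHom_id : tensorHom M (idLO X) = idLO (OctExt (nucleus M ⊗[ℝ] nucleus X)) :=
  Subtype.ext tensorMap_id
end OctBimodule

set_option linter.checkUnivs false in
/-- A non-associative category: composition has identities but need not be associative. -/
structure NonassocCategory where
  Obj : Type u₁
  Hom : Obj → Obj → Type v₁
  id : ∀ X, Hom X X
  comp : ∀ {X Y Z}, Hom Y Z → Hom X Y → Hom X Z
  comp_id : ∀ {X Y} (f : Hom X Y), comp f (id X) = f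
  id_comp : ∀ {X Y} (f : Hom X Y), comp (id Y) f = f

/-- A covariant functor between non-associative categories. -/
structure NonassocFunctor (C : NonassocCategory.{u₁, v₁}) (D : NonassocCategory.{u₂, v₂}) where
  obj : C.Obj → D.Obj
  map : ∀ {X Y}, C.Hom X Y → D.Hom (obj X) (obj Y)
  map_comp : ∀ {X Y Z} (g : C.Hom Y Z) (f : C.Hom X Y),
    map (C.comp g f) = D.comp (map g) (map f)
  map_id : ∀ X, map (C.id X) = D.id (obj X)

/-- A contravariant functor between non-associative categories. -/
structure NonassocContraFunctor (C : NonassocCategory.{u₁, v₁})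
    (D : NonassocCategory.{u₂, v₂}) where
  obj : C.Obj → D.Obj
  map : ∀ {X Y}, C.Hom X Y → D.Hom (obj Y) (obj X)
  map_comp : ∀ {X Y Z} (g : C.Hom Y Z) (f : C.Hom X Y),
    map (C.comp g f) = D.comp (map f) (map g)
  map_id : ∀ X, map (C.id X) = D.id (obj X)

/-- A bundled `𝕆`-bimodule. -/
structure OBimod : Type (u + 1) where
  carrier : Type u
  [addCommGroup : AddCommGroup carrier]
  [module : Module ℝ carrier]
  [octBimodule : OctBimodule carrier]

namespace OBimod
open OctBimodule

instance : CoeSort OBimod.{u} (Type u) := ⟨carrier⟩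
attribute [instance] addCommGroup module octBimodule

/-- Left para-linear maps, composed by the left regular composition. -/
noncomputable def LO : NonassocCategory.{u + 1, u} where
  Obj := OBimod.{u}
  Hom M X := HomLO M X
  id M := idLO M
  comp f g := compLO f g
  comp_id f := Subtype.ext (lComp_id f.1)
  id_comp f := Subtype.ext (id_lComp f.2)

/-- Right para-linear maps, composed by the right regular composition. -/
noncomputable def RO : NonassocCategory.{u + 1, u} where
  Obj := OBimod.{u}
  Hom M X := HomRO M X
  id M := idRO M
  comp f g := compRO f g
  comp_id f := Subtype.ext (rComp_id f.1)
  id_comp f := Subtype.ext (id_rComp f.2)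

/-- The category `𝕆-Mod_ℝ`: all real linear maps, with the usual composition. -/
def OModR : NonassocCategory.{u + 1, u} where
  Obj := OBimod.{u}
  Hom M X := M →ₗ[ℝ] X
  id _ := LinearMap.id
  comp f g := f ∘ₗ g
  comp_id _ := rfl
  id_comp _ := rfl

/-- The embedding `ι : 𝓛𝕆 → 𝕆-Mod_ℝ` on morphisms (it is the identity on objects). -/
def ιL {X Y : OBimod.{u}} (f : LO.{u}.Hom X Y) : OModR.{u}.Hom X Y :=
  Subtype.val f

/-- The embedding `ι : 𝓡𝕆 → 𝕆-Mod_ℝ` on morphisms (it is the identity on objects). -/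
def ιR {X Y : OBimod.{u}} (f : RO.{u}.Hom X Y) : OModR.{u}.Hom X Y :=
  Subtype.val f

/-- Exactness of `X → X' → X''` at `X'` in `𝕆-Mod_ℝ`. -/
def OModR.ExactAt {X X' X'' : OBimod.{u}} (f : OModR.{u}.Hom X X')
    (g : OModR.{u}.Hom X' X'') : Prop :=
  LinearMap.range (f : X →ₗ[ℝ] X') = LinearMap.ker (g : X' →ₗ[ℝ] X'')

/-- Exactness of `0 → X → X' → X''` in `𝕆-Mod_ℝ`. -/
def OModR.LeftExactSeq {X X' X'' : OBimod.{u}} (f : OModR.{u}.Hom X X')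
    (g : OModR.{u}.Hom X' X'') : Prop :=
  LinearMap.ker (f : X →ₗ[ℝ] X') = ⊥ ∧ ExactAt f g

/-- Exactness of `X → X' → X'' → 0` in `𝕆-Mod_ℝ`. -/
def OModR.RightExactSeq {X X' X'' : OBimod.{u}} (f : OModR.{u}.Hom X X')
    (g : OModR.{u}.Hom X' X'') : Prop :=
  ExactAt f g ∧ LinearMap.range (g : X' →ₗ[ℝ] X'') = ⊤

/-- A sequence `0 → X → X' → X''` in `𝓛𝕆` is exact if its image under `ι` is. -/
def LO.LeftExactSeq {X X' X'' : OBimod.{u}} (f : LO.{u}.Hom X X') (g : LO.{u}.Hom X' X'') : Prop :=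
  OModR.LeftExactSeq (ιL f) (ιL g)

/-- A sequence `X → X' → X'' → 0` in `𝓛𝕆` is exact if its image under `ι` is. -/
def LO.RightExactSeq {X X' X'' : OBimod.{u}} (f : LO.{u}.Hom X X') (g : LO.{u}.Hom X' X'') :
    Prop :=
  OModR.RightExactSeq (ιL f) (ιL g)

/-- A sequence `0 → X → X' → X''` in `𝓡𝕆` is exact if its image under `ι` is. -/
def RO.LeftExactSeq {X X' X'' : OBimod.{u}} (f : RO.{u}.Hom X X') (g : RO.{u}.Hom X' X'') : Prop :=
  OModR.LeftExactSeq (ιR f) (ιR g)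

/-- `F : 𝓛𝕆 → 𝓛𝕆` is left exact. -/
def IsLeftExact (F : NonassocFunctor LO.{u} LO.{u}) : Prop :=
  ∀ {X X' X'' : OBimod.{u}} (f : LO.{u}.Hom X X') (g : LO.{u}.Hom X' X''),
    LO.LeftExactSeq f g → LO.LeftExactSeq (F.map f) (F.map g)

/-- `F : 𝓛𝕆 → 𝓛𝕆` is right exact. -/
def IsRightExact (F : NonassocFunctor LO.{u} LO.{u}) : Prop :=
  ∀ {X X' X'' : OBimod.{u}} (f : LO.{u}.Hom X X') (g : LO.{u}.Hom X' X''),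
    LO.RightExactSeq f g → LO.RightExactSeq (F.map f) (F.map g)

/-- A contravariant `F : 𝓛𝕆 → 𝓡𝕆` is left exact: it turns exact sequences `X → X' → X'' → 0`
into exact sequences `0 → F X'' → F X' → F X`. -/
def IsContraLeftExact (F : NonassocContraFunctor LO.{u} RO.{u}) : Prop :=
  ∀ {X X' X'' : OBimod.{u}} (f : LO.{u}.Hom X X') (g : LO.{u}.Hom X' X''),
    LO.RightExactSeq f g → RO.LeftExactSeq (F.map g) (F.map f)

/-- The functor `Hom_𝓛𝕆(M, -) : 𝓛𝕆 → 𝓛𝕆`, sending `f` to `g ↦ f ⊚ g`. -/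
noncomputable def homFunctor (M : OBimod.{u}) : NonassocFunctor LO.{u} LO.{u} where
  obj := fun X : OBimod.{u} => OBimod.mk (HomLO M X)
  map := fun {X Y : OBimod.{u}} (f : HomLO X Y) => homMap M f
  map_comp := fun {X Y Z : OBimod.{u}} (g : HomLO Y Z) (f : HomLO X Y) => homMap_comp g f
  map_id := fun X : OBimod.{u} => homMap_id (X := X)

/-- The contravariant functor `Hom_𝓛𝕆(-, M) : 𝓛𝕆 → 𝓡𝕆`, sending `f` to `g ↦ g ⊚ f`. -/
noncomputable def contraHomFunctor (M : OBimod.{u}) : NonassocContraFunctor LO.{u} RO.{u} where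
  obj := fun X : OBimod.{u} => OBimod.mk (HomLO X M)
  map := fun {X Y : OBimod.{u}} (f : HomLO X Y) => contraHomMap M f
  map_comp := fun {X Y Z : OBimod.{u}} (g : HomLO Y Z) (f : HomLO X Y) => contraHomMap_comp g f
  map_id := fun X : OBimod.{u} => contraHomMap_id (X := X)

/-- The tensor functor `M ⊗_𝕆 - : 𝓛𝕆 → 𝓛𝕆`, with `M ⊗_𝕆 X = (Re M ⊗_ℝ Re X) ⊗_ℝ 𝕆`. -/
noncomputable def tensorFunctor (M : OBimod.{u}) : NonassocFunctor LO.{u} LO.{u} where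
  obj := fun X : OBimod.{u} => OBimod.mk (OctExt (nucleus M ⊗[ℝ] nucleus X))
  map := fun {X Y : OBimod.{u}} (f : HomLO X Y) => tensorHom M f
  map_comp := fun {X Y Z : OBimod.{u}} (g : HomLO Y Z) (f : HomLO X Y) => tensorHom_comp g f
  map_id := fun X : OBimod.{u} => tensorHom_id (X := X)

end OBimod

/-! Exactness only concerns underlying real-linear maps, so it suffices to identify each functor, on
underlying real spaces, with a familiar functor of real vector spaces. These identifications absorb
the correction terms in the regular composition.

A left para-linear map `M → X` can be encoded by real-linear data in two ways. It is determined by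
its restriction to `Re M`, and any real-linear map `Re M → X` is such a restriction
(`extendNucleus`). It is also determined by its real part, and any real-linear map `M → Re X` is
such a real part (`ofRe`). So `Hom(M, X)` is both `Hom_ℝ(Re M, X)` and `Hom_ℝ(M, Re X)`.

The first description suits the covariant functor: on `Re M` the correction terms of `f ⊚ g` vanish,
so `g ↦ f ⊚ g` becomes ordinary composition with `f`. The second suits the contravariant functor:
each correction term is `eⱼ` times a real element and has no real part, so `Re (g ⊚ f) = (Re g) ∘
f`. For the tensor functor, `m ⊗ x ↦ m ⊗_𝕆 x` is a real isomorphism `Re M ⊗_ℝ X ≃ M ⊗_𝕆 X`, natural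
in left para-linear maps, which turns `1 ⊗ f` into the ordinary `f.lTensor`
(`tensorMap_nucleusTensorEquiv`).

What remains is linear algebra over a field. Preimages for the two Hom functors come from one-sided
inverses that are merely real-linear; `extendNucleus` and `ofRe` turn the results into left
para-linear maps. For the tensor functor, right exactness of the real tensor product is transported
along the isomorphism. -/

namespace OctBimodule
open Octonion
section
variable {M : Type u} [AddCommGroup M] [Module ℝ M] [OctBimodule M]
variable {X : Type u} [AddCommGroup X] [Module ℝ X] [OctBimodule X]
variable {Y : Type u} [AddCommGroup Y] [Module ℝ Y] [OctBimodule Y]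
variable {Z : Type u} [AddCommGroup Z] [Module ℝ Z] [OctBimodule Z]

/-! ### Extending real-linear maps from the real part -/

/-- The coordinates of `M` with respect to `e₀, …, e₇`, as a map into `Re M ⊗ 𝕆`. -/
noncomputable def toOctExt : M →ₗ[ℝ] OctExt (nucleus M) :=
  ∑ i : Fin 8, OctExt.mk.flip (e i) ∘ₗ coord i

/-- For real `z` the `i`-th coordinate of `p z` is `pᵢ z` (`coord_L`), and the `pᵢ eᵢ` add up to
`p`. This is what lets `lExt`, available only on `V ⊗ 𝕆`, be used on an arbitrary bimodule. -/
theorem toOctExt_L (p : Octonion) (z : nucleus M) :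
    toOctExt (L p (z : M)) = OctExt.mk z p := by
  have h : p = ∑ j : Fin 8, p j • e j := by
    rw [Fin.sum_univ_succ]
    exact eq_sum p
  conv_rhs => rw [h, map_sum]
  simp only [toOctExt, LinearMap.sum_apply, LinearMap.comp_apply, LinearMap.flip_apply]
  refine Finset.sum_congr rfl fun j _ => ?_
  rw [coord_L j p z.2, map_smul, LinearMap.smul_apply, map_smul]

/-- The left para-linear map with prescribed real linear values on `Re M`. -/
noncomputable def extendNucleus (φ : nucleus M →ₗ[ℝ] X) : M →ₗ[ℝ] X := lExt φ ∘ₗ toOctExt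

theorem extendNucleus_L (φ : nucleus M →ₗ[ℝ] X) (p : Octonion) (z : nucleus M) :
    extendNucleus φ (L p (z : M)) = L p (φ z) := by
  rw [extendNucleus, LinearMap.comp_apply, toOctExt_L, lExt_mk]

theorem extendNucleus_coe (φ : nucleus M →ₗ[ℝ] X) (z : nucleus M) :
    extendNucleus φ (z : M) = φ z := by
  have h := extendNucleus_L φ 1 z
  rwa [one_L, one_L] at h

/-- Left para-linearity amounts to commuting with left multiplication on real elements only
(`mem_HomLO_iff`), and the extension is defined by exactly that rule. -/
theorem extendNucleus_mem (φ : nucleus M →ₗ[ℝ] X) : extendNucleus φ ∈ HomLO M X :=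
  mem_HomLO_iff.mpr fun p x hx => by
    rw [extendNucleus_L φ p ⟨x, hx⟩, extendNucleus_coe φ ⟨x, hx⟩]

/-! ### Left exactness of the covariant Hom functor -/

/-- The regular composition is left para-linear, hence determined on `Re M`, where it agrees with
the ordinary one. The values `g x` need not be real, so `f` is seen here as a real-linear map on all
of `X`. -/
theorem postComp_eq_zero_iff (f : HomLO X Y) (g : HomLO M X) :
    postComp M f g = 0 ↔ ∀ x ∈ nucleus M, f.1 (g.1 x) = 0 := by
  constructor
  · intro h x hx
    rw [← lComp_of_mem f.1 g.2 hx, ← postComp_apply, h]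
    rfl
  · intro h
    refine Subtype.ext (HomLO_ext (SetLike.coe_mem _) (SetLike.coe_mem _) fun x hx => ?_)
    rw [postComp_apply, lComp_of_mem _ g.2 hx, h x hx]
    rfl

theorem ker_postComp (f : HomLO X Y) (hf : LinearMap.ker f.1 = ⊥) :
    LinearMap.ker (postComp M f) = ⊥ := by
  refine LinearMap.ker_eq_bot'.mpr fun g hg => ?_
  refine Subtype.ext (HomLO_ext (SetLike.coe_mem _) (SetLike.coe_mem _) fun x hx => ?_)
  exact LinearMap.ker_eq_bot'.mp hf _ ((postComp_eq_zero_iff f g).mp hg x hx)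

theorem range_postComp (f : HomLO X Y) (g : HomLO Y Z) (hf : LinearMap.ker f.1 = ⊥)
    (h : LinearMap.range f.1 = LinearMap.ker g.1) :
    LinearMap.range (postComp M f) = LinearMap.ker (postComp M g) := by
  ext k
  rw [LinearMap.mem_ker, postComp_eq_zero_iff]
  constructor
  · rintro ⟨k, rfl⟩ x hx
    rw [postComp_apply, lComp_of_mem _ k.2 hx, ← LinearMap.mem_ker, ← h]
    exact LinearMap.mem_range_self _ _
  · intro hk
    -- Over a field the injective `f` has a real-linear retraction `s`. It need not respect the
    -- octonions: only `s ∘ k` on `Re M` is used, and the extension restores para-linearity.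
    obtain ⟨s, hs⟩ := f.1.exists_leftInverse_of_injective hf
    refine ⟨⟨_, extendNucleus_mem (s ∘ₗ k.1 ∘ₗ (nucleus M).subtype)⟩, ?_⟩
    refine Subtype.ext (HomLO_ext (SetLike.coe_mem _) (SetLike.coe_mem _) fun x hx => ?_)
    rw [postComp_apply, lComp_of_mem _ (SetLike.coe_mem _) hx]
    -- Exactness puts `k x` in the image of `f`, where `f ∘ s` is the identity.
    have hr : k.1 x ∈ LinearMap.range f.1 := h ▸ hk x hx
    obtain ⟨y, hy⟩ := hr
    have hsy : s (f.1 y) = y := LinearMap.congr_fun hs y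
    rw [extendNucleus_coe _ ⟨x, hx⟩]
    simp [← hy, hsy]

/-! ### Reconstructing a left para-linear map from its real part -/

/-- A left para-linear map is determined by its real part. -/
theorem HomLO_ext_re {f g : M →ₗ[ℝ] X} (hf : f ∈ HomLO M X) (hg : g ∈ HomLO M X)
    (h : re ∘ₗ f = re ∘ₗ g) : f = g := by
  ext x
  rw [← sub_eq_zero]
  -- An element `m` vanishes once every `Re (p m)` does, and para-linearity gives `Re (p f(x)) = Re
  -- f(p x)`, a value of the real part of `f`.
  refine eq_zero_of_re fun p => ?_
  have h1 := hf p x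
  have h2 := hg p x
  have h3 := LinearMap.congr_fun h (L p x)
  rw [lAssoc_apply, map_sub] at h1 h2
  simp only [LinearMap.comp_apply] at h3
  rw [map_sub, map_sub]
  linear_combination (norm := module) h2 - h1 + h3

/-- The left para-linear map with prescribed real part `φ`. -/
noncomputable def ofRe (φ : M →ₗ[ℝ] nucleus X) : M →ₗ[ℝ] X :=
  (nucleus X).subtype ∘ₗ φ
    - ∑ i : Fin 7, L (e i.succ) ∘ₗ (nucleus X).subtype ∘ₗ φ ∘ₗ L (e i.succ)

theorem ofRe_apply (φ : M →ₗ[ℝ] nucleus X) (x : M) :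
    ofRe φ x = (φ x : X) - ∑ i : Fin 7, L (e i.succ) (φ (L (e i.succ) x) : X) := by
  simp [ofRe]

theorem re_ofRe (φ : M →ₗ[ℝ] nucleus X) (x : M) : re (ofRe φ x) = φ x := by
  rw [ofRe_apply, map_sub, map_sum, re_eq_self (φ x).2]
  simp only [re_L_e (SetLike.coe_mem _), Finset.sum_const_zero, sub_zero]

/-- The formula for `ofRe` is forced: in the expansion `decomp` of `f(x)`, para-linearity replaces
`Re (eᵢ f(x))` by `Re f(eᵢ x) = φ(eᵢ x)`. Conversely, multiplying by `p` and taking real parts, the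
`i`-th term contributes its coefficient `(p eᵢ)₀ = -pᵢ`, and the sum reassembles `φ(p x)`.
Para-linearity of `ofRe φ` is this identity combined with `re_ofRe`. -/
theorem re_L_ofRe (φ : M →ₗ[ℝ] nucleus X) (p : Octonion) (x : M) :
    re (L p (ofRe φ x)) = φ (L p x) := by
  have h0 : ∀ i : Fin 7, (p * e i.succ) 0 = - p i.succ := by
    intro i
    fin_cases i <;> simp [e_apply]
  rw [ofRe_apply]
  simp only [map_sub, map_sum, L_L_of_mem (SetLike.coe_mem _), re_L_of_mem (SetLike.coe_mem _), h0]
  conv_rhs => rw [eq_sum p]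
  simp [one_L]

theorem ofRe_mem (φ : M →ₗ[ℝ] nucleus X) : ofRe φ ∈ HomLO M X := fun p x => by
  rw [lAssoc_apply, map_sub, re_ofRe, re_L_ofRe, sub_self]

/-- Every correction term is an imaginary unit times a real element, so it has no real part. On real
parts, precomposition is therefore ordinary precomposition. -/
theorem re_lComp (f : X →ₗ[ℝ] Y) (g : M →ₗ[ℝ] X) (x : M) : re (lComp f g x) = re (f (g x)) := by
  rw [lComp_apply, map_sub, map_sum]
  simp only [re_L_e (re_mem _), Finset.sum_const_zero, sub_zero]

/-! ### Left exactness of the contravariant Hom functor -/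

/-- The counterpart of `postComp_eq_zero_iff` with the other encoding: all arguments are tested, but
only the real part of the value. -/
theorem preComp_eq_zero_iff (f : HomLO X Y) (g : HomLO Y M) :
    preComp M f g = 0 ↔ ∀ x, re (g.1 (f.1 x)) = 0 := by
  constructor
  · intro h x
    rw [← re_lComp, ← preComp_apply, h]
    exact map_zero re
  · intro h
    refine Subtype.ext (HomLO_ext_re (SetLike.coe_mem _) (SetLike.coe_mem _) ?_)
    ext x
    rw [LinearMap.comp_apply, preComp_apply, re_lComp, h x]
    exact (map_zero re).symm

theorem ker_preComp (f : HomLO X Y) (hf : LinearMap.range f.1 = ⊤) :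
    LinearMap.ker (preComp M f) = ⊥ := by
  refine LinearMap.ker_eq_bot'.mpr fun g hg => ?_
  refine Subtype.ext (HomLO_ext_re (SetLike.coe_mem _) (SetLike.coe_mem _) ?_)
  ext y
  obtain ⟨x, rfl⟩ := LinearMap.range_eq_top.mp hf y
  rw [LinearMap.comp_apply, (preComp_eq_zero_iff f g).mp hg x]
  exact (map_zero re).symm

theorem range_preComp (f : HomLO X Y) (g : HomLO Y Z)
    (h : LinearMap.range f.1 = LinearMap.ker g.1) (hg : LinearMap.range g.1 = ⊤) :
    LinearMap.range (preComp M g) = LinearMap.ker (preComp M f) := by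
  ext k
  rw [LinearMap.mem_ker, preComp_eq_zero_iff]
  constructor
  · rintro ⟨k, rfl⟩ x
    have hx : g.1 (f.1 x) = 0 := by
      rw [← LinearMap.mem_ker, ← h]
      exact LinearMap.mem_range_self _ _
    rw [preComp_apply, re_lComp, hx, map_zero, map_zero]
  · intro hk
    -- Again `s` is only a real-linear section of `g`. The preimage of `k` is the left para-linear
    -- map with real part `Re k ∘ s`.
    obtain ⟨s, hs⟩ := g.1.exists_rightInverse_of_surjective hg
    let κ : Y →ₗ[ℝ] nucleus M := (re ∘ₗ k.1).codRestrict (nucleus M) fun _ => re_mem _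
    refine ⟨⟨_, ofRe_mem (κ ∘ₗ s)⟩, ?_⟩
    refine Subtype.ext (HomLO_ext_re (SetLike.coe_mem _) (SetLike.coe_mem _) ?_)
    ext y
    rw [LinearMap.comp_apply, preComp_apply, re_lComp, re_ofRe]
    change re (k.1 (s (g.1 y))) = re (k.1 y)
    -- The section recovers `y` up to the kernel of `g`, which is the image of `f`; by `hk` the real
    -- part of `k` vanishes there.
    have hy : s (g.1 y) - y ∈ LinearMap.range f.1 := by
      rw [h, LinearMap.mem_ker, map_sub, sub_eq_zero]
      exact LinearMap.congr_fun hs (g.1 y)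
    obtain ⟨x, hx⟩ := hy
    rw [← sub_eq_zero, ← map_sub, ← map_sub, ← hx, hk x]

/-! ### The octonionic tensor product as a real tensor product -/

variable (M X) in
/-- `Re M ⊗_ℝ X → M ⊗_𝕆 X`, `m ⊗ x ↦ m ⊗_𝕆 x`. -/
noncomputable def ofNucleusTensor :
    nucleus M ⊗[ℝ] X →ₗ[ℝ] OctExt (nucleus M ⊗[ℝ] nucleus X) :=
  TensorProduct.lift (octTmul ∘ₗ (nucleus M).subtype)

variable (M X) in
/-- `M ⊗_𝕆 X → Re M ⊗_ℝ X`, `(m ⊗ x) ⊗ p ↦ m ⊗ p x`. -/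
noncomputable def toNucleusTensor :
    OctExt (nucleus M ⊗[ℝ] nucleus X) →ₗ[ℝ] nucleus M ⊗[ℝ] X :=
  -- Built as a function of `p` first: left multiplication by `p`, restricted to `Re X`, then
  -- tensored with `Re M`. The `flip` puts the tensor before `p`, as `OctExt.lift` expects.
  OctExt.lift (LinearMap.lTensorHom (nucleus M) ∘ₗ
    LinearMap.lcomp ℝ X (nucleus X).subtype ∘ₗ L).flip

theorem ofNucleusTensor_tmul (m : nucleus M) (x : X) :
    ofNucleusTensor M X (m ⊗ₜ[ℝ] x) = octTmul (m : M) x := by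
  rw [ofNucleusTensor, TensorProduct.lift.tmul, LinearMap.comp_apply, Submodule.coe_subtype]

theorem toNucleusTensor_mk (m : nucleus M) (x : nucleus X) (p : Octonion) :
    toNucleusTensor M X (OctExt.mk (m ⊗ₜ[ℝ] x) p) = m ⊗ₜ[ℝ] L p (x : X) := by
  rw [toNucleusTensor, OctExt.lift_mk, LinearMap.flip_apply, LinearMap.comp_apply,
    LinearMap.comp_apply, LinearMap.coe_lTensorHom, LinearMap.lTensor_tmul, LinearMap.lcomp_apply,
    Submodule.coe_subtype]

theorem ofNucleusTensor_comp_toNucleusTensor :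
    ofNucleusTensor M X ∘ₗ toNucleusTensor M X = LinearMap.id := by
  refine OctExt.hom_ext fun t p => ?_
  have h : (ofNucleusTensor M X ∘ₗ toNucleusTensor M X) ∘ₗ OctExt.mk.flip p
      = OctExt.mk.flip p := TensorProduct.ext' fun m x => by
    rw [LinearMap.comp_apply, LinearMap.comp_apply, LinearMap.flip_apply, toNucleusTensor_mk,
      ofNucleusTensor_tmul, octTmul_L_of_mem]
  exact LinearMap.congr_fun h t

theorem toNucleusTensor_comp_ofNucleusTensor :
    toNucleusTensor M X ∘ₗ ofNucleusTensor M X = LinearMap.id := by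
  refine TensorProduct.ext' fun m x => ?_
  -- Here `x` is an arbitrary element of `X`. Fixing `m` makes both sides linear in `x`, so by
  -- `ext_mul` it suffices to treat `x = q z` with `z` real, where both maps are explicit.
  have h : (toNucleusTensor M X ∘ₗ ofNucleusTensor M X) ∘ₗ TensorProduct.mk ℝ (nucleus M) X m
      = TensorProduct.mk ℝ (nucleus M) X m := ext_mul fun q z hz => by
    rw [LinearMap.comp_apply, LinearMap.comp_apply, TensorProduct.mk_apply, ofNucleusTensor_tmul,
      octTmul_L_of_mem m ⟨z, hz⟩, toNucleusTensor_mk]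
  exact LinearMap.congr_fun h x

variable (M X) in
/-- `Re M ⊗_ℝ X ≃ M ⊗_𝕆 X`, `m ⊗ x ↦ m ⊗_𝕆 x`. -/
noncomputable def nucleusTensorEquiv :
    nucleus M ⊗[ℝ] X ≃ₗ[ℝ] OctExt (nucleus M ⊗[ℝ] nucleus X) :=
  LinearEquiv.ofLinearMap (ofNucleusTensor M X) (toNucleusTensor M X)
    ofNucleusTensor_comp_toNucleusTensor toNucleusTensor_comp_ofNucleusTensor

theorem coe_nucleusTensorEquiv :
    (nucleusTensorEquiv M X).toLinearMap = ofNucleusTensor M X := rfl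

/-- Naturality of the identification. By construction `tensorMap M f` sees `f` only on `Re X`;
para-linearity, through `f(q z) = q f(z)` for real `z`, makes it agree with `m ⊗_𝕆 f(x)` for every
`x`. -/
theorem tensorMap_nucleusTensorEquiv {f : X →ₗ[ℝ] Y} (hf : f ∈ HomLO X Y) :
    tensorMap M f ∘ₗ (nucleusTensorEquiv M X).toLinearMap
      = (nucleusTensorEquiv M Y).toLinearMap ∘ₗ f.lTensor (nucleus M) :=
  TensorProduct.ext' fun m x => by
    rw [coe_nucleusTensorEquiv, coe_nucleusTensorEquiv, LinearMap.comp_apply,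
      LinearMap.comp_apply, ofNucleusTensor_tmul, LinearMap.lTensor_tmul, ofNucleusTensor_tmul,
      tensorMap_octTmul hf]

/-! ### Right exactness of the tensor functor -/

theorem range_tensorMap_eq_top {g : Y →ₗ[ℝ] Z} (hg : g ∈ HomLO Y Z)
    (hs : LinearMap.range g = ⊤) : LinearMap.range (tensorMap M g) = ⊤ := by
  have h : Function.Surjective (tensorMap M g ∘ₗ (nucleusTensorEquiv M Y).toLinearMap) := by
    rw [tensorMap_nucleusTensorEquiv hg]
    exact (nucleusTensorEquiv M Z).surjective.comp
      (LinearMap.lTensor_surjective _ (LinearMap.range_eq_top.mp hs))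
  exact LinearMap.range_eq_top.mpr (Function.Surjective.of_comp h)

theorem range_tensorMap {f : X →ₗ[ℝ] Y} {g : Y →ₗ[ℝ] Z} (hf : f ∈ HomLO X Y)
    (hg : g ∈ HomLO Y Z) (h : LinearMap.range f = LinearMap.ker g)
    (hs : LinearMap.range g = ⊤) :
    LinearMap.range (tensorMap M f) = LinearMap.ker (tensorMap M g) := by
  have hl := lTensor_exact (nucleus M) (LinearMap.exact_iff.mpr h.symm)
    (LinearMap.range_eq_top.mp hs)
  -- The two naturality squares, for `f` and for `g`, form a ladder of isomorphisms along which
  -- exactness of the real tensor sequence is carried over.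
  exact (LinearMap.exact_iff.mp ((Function.Exact.iff_of_ladder_linearEquiv
    (tensorMap_nucleusTensorEquiv hf) (tensorMap_nucleusTensorEquiv hg)).mpr hl)).symm
end
end OctBimodule

/-! ### The theorem -/

open OctBimodule in
theorem mainTheorem4 (M : OBimod.{u}) :
    OBimod.IsLeftExact (OBimod.homFunctor M) ∧
      OBimod.IsContraLeftExact (OBimod.contraHomFunctor M) ∧
      OBimod.IsRightExact (OBimod.tensorFunctor M) := by
  refine ⟨?_, ?_, ?_⟩
  · intro X Y Z f g h
    exact ⟨ker_postComp f h.1, range_postComp f g h.1 h.2⟩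
  · intro X Y Z f g h
    -- The arrows are reversed: surjectivity of `g` yields injectivity of the first map, and it is
    -- needed again for exactness in the middle.
    exact ⟨ker_preComp g h.2, range_preComp f g h.1 h.2⟩
  · intro X Y Z f g h
    exact ⟨range_tensorMap f.2 g.2 h.1 h.2, range_tensorMap_eq_top g.2 h.2⟩
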